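/- \textbf{Theorem (Reconstruction Formula in $L^2$).} Let $m\ge 1$. Write $\widehat\varphi(\zeta)=\int_{\mathbb R}\varphi(x)e^{-ix\zeta}\,dx$ for $\varphi\in\mathcal S(\mathbb R)$, and $\langle\widehat\eta,\varphi\rangle=\langle\eta,\widehat\varphi\rangle$ for $\eta\in\mathcal S'(\mathbb R)$. \emph{Admissibility.} A pair $(\psi,\eta)\in\mathcal S(\mathbb R)\times\mathcal S'(\mathbb R)$ is \emph{admissible} if there is an open neighbourhood $\Omega$ of $0$ such that $\widehat\eta$ is a locally integrable function on $\Omega\setminus\{0\}$, the Lebesgue integral $\int_{\Omega\setminus\{0\}}\overline{\widehat\psi(\zeta)}\,\widehat\eta(\zeta)|\zeta|^{-m}d\zeta$ converges absolutely, and $$K_{\psi,\eta}:=(2\pi)^{m-1}\Big(\int_{\Omega\setminus\{0\}}+\int_{\mathbb R\setminus\Omega}\Big)\frac{\overline{\widehat\psi(\zeta)}\,\widehat\eta(\zeta)}{|\zeta|^m}\,d\zeta$$ is not zero; here the part near $0$ is a Lebesgue integral and the part away from $0$ is the action of the distribution $\widehat\eta$, the two parts being separated by a smooth compactly supported cut-off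 $\chi$ with support in $\Omega$ and $\chi=1$ near $0$ (the value does not depend on $\Omega$ and $\chi$). A function $\psi\in\mathcal S(\mathbb R)$ is \emph{self-admissible} if $(\psi,\psi)$ is admissible. Two admissible pairs $(\psi,\eta)$, $(\psi^\star,\eta^\star)$ are \emph{equivalent} if $\overline{\widetilde\psi}*\eta=\overline{\widetilde{\psi^\star}}*\eta^\star$, where $\widetilde\psi(z)=\psi(-z)$. An admissible pair is \emph{admissibly decomposable} if it is equivalent to a pair $(\psi^\star,\eta^\star)$ with $\psi^\star,\eta^\star\in\mathcal S(\mathbb R)$ self-admissible. \emph{Transforms.} For $f$ on $\mathbb R^m$, $u\in\mathbb S^{m-1}$ and $p\in\mathbb R$ let $\mathrm Rf(u,p)=\int_{(\mathbb Ru)^\perp}f(pu+y)\,dy$ be the Radon transform, and let $$\mathscr R_\psi f(u,\alpha,\beta)=\int_{\mathbb R}\mathrm Rf(u,\alpha z+\beta)\,\overline{\psi(z)}\,dz\qquad(\alpha>0,\ \beta\in\mathbb R).$$ For $0<\varepsilon<\delta<\infty$ put $$I_{\varepsilon,\delta}f(x)=\int_{\mathbb S^{m-1}}\int_\varepsilon^\delta\Big[\int_{\mathbb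 R}\mathscr R_\psi f(u,\alpha,u\cdot x-\alpha z)\,\eta(z)\,dz\Big]\frac{d\alpha\,du}{\alpha^m},$$ where $du$ is the surface measure and $\int_{\mathbb R}\cdot\,\eta(z)\,dz$ is the action of $\eta$. This is literal for $f\in\mathcal S(\mathbb R^m)$; for $f\in L^1(\mathbb R^m)$ the bracket is understood in convolution form, as $\int_{\mathbb R}\mathrm Rf(u,p)\,\alpha^{-1}\big(\overline{\widetilde\psi}*\eta\big)\big(\tfrac{u\cdot x-p}{\alpha}\big)\,dp$. \emph{Claim.} Let $(\psi,\eta)\in\mathcal S(\mathbb R)\times\mathcal S'(\mathbb R)$ be admissibly decomposable with $K_{\psi,\eta}=1$. Then for all $0<\varepsilon<\delta<\infty$ the following holds. For every $f\in\mathcal S(\mathbb R^m)$, $\alpha>0$, $\beta\in\mathbb R$ and $u\in\mathbb S^{m-1}$ the function $z\mapsto\mathscr R_\psi f(u,\alpha,\beta-\alpha z)$ is a Schwartz function; for $f\in\mathcal S(\mathbb R^m)$ and for $f\in L^1(\mathbb R^m)$ the integral over $\mathbb S^{m-1}\times(\varepsilon,\delta)$ defining $I_{\varepsilon,\delta}f(x)$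 converges absolutely for every $x$ (and, for $f\in L^1$, so does the integral in $p$); and there is exactly one bounded linear operator $I_{\varepsilon,\delta}:L^2(\mathbb R^m)\to L^2(\mathbb R^m)$ which is given almost everywhere by the above formulas for $f\in\mathcal S(\mathbb R^m)$ and for $f\in L^1\cap L^2(\mathbb R^m)$. Moreover, for every $f\in L^2(\mathbb R^m)$, $$\mathscr R^\dagger_\eta\mathscr R_\psi f=\lim_{\varepsilon\to0,\ \delta\to\infty}I_{\varepsilon,\delta}f=f\quad\text{in }L^2(\mathbb R^m).$$ -/

import Mathlib

open MeasureTheory Filter Topology Set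
open scoped SchwartzMap FourierTransform ComplexConjugate ContDiff RealInnerProductSpace

noncomputable section

namespace Ridgelet

/-! ### Fourier transform on the line, in the normalisation `∫ f(x) e^{-i x ζ} dx` -/

/-- The dilation `ζ ↦ (2π)⁻¹ ζ` of the line. -/
def twoPiInvScale : ℝ ≃L[ℝ] ℝ :=
  ContinuousLinearEquiv.unitsEquivAut ℝ (Units.mk0 ((2 * Real.pi)⁻¹) (by positivity))

/-- The Fourier transform `φ̂(ζ) = ∫ φ(x) e^{-i x ζ} dx` of a Schwartz function on the line. -/
def fourierHat : 𝓢(ℝ, ℂ) →L[ℂ] 𝓢(ℝ, ℂ) :=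
  (SchwartzMap.compCLMOfContinuousLinearEquiv ℂ twoPiInvScale).comp
    (FourierTransform.fourierCLM ℂ 𝓢(ℝ, ℂ))

theorem fourierHat_apply (φ : 𝓢(ℝ, ℂ)) (ζ : ℝ) :
    fourierHat φ ζ = ∫ x : ℝ, φ x * Complex.exp (-(Complex.I * x * ζ)) := by
  have h : fourierHat φ ζ = 𝓕 (φ : ℝ → ℂ) (ζ * (2 * Real.pi)⁻¹) := by
    rw [← SchwartzMap.fourier_coe]
    rfl
  rw [h, Real.fourier_real_eq_integral_exp_smul]
  refine integral_congr_ae (ae_of_all _ fun x => ?_)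
  simp only [smul_eq_mul]
  rw [mul_comm]
  congr 2
  have : (Real.pi : ℂ) ≠ 0 := by exact_mod_cast Real.pi_ne_zero
  push_cast
  field_simp

/-- The Fourier transform of a tempered distribution, `⟨η̂, φ⟩ = ⟨η, φ̂⟩`. -/
def distHat (η : 𝓢'(ℝ, ℂ)) (φ : 𝓢(ℝ, ℂ)) : ℂ := η (fourierHat φ)

open Classical in
/-- The action `∫ h(z) η(z) dz` of a tempered distribution on a function `h` that is a Schwartz
function (and `0` if `h` is not a Schwartz function). -/
def distAction (η : 𝓢'(ℝ, ℂ)) (h : ℝ → ℂ) : ℂ :=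
  if H : ∃ φ : 𝓢(ℝ, ℂ), ⇑φ = h then η H.choose else 0

theorem distAction_coe (η : 𝓢'(ℝ, ℂ)) (φ : 𝓢(ℝ, ℂ)) : distAction η φ = η φ := by
  have H : ∃ φ' : 𝓢(ℝ, ℂ), (φ' : ℝ → ℂ) = φ := ⟨φ, rfl⟩
  rw [distAction, dif_pos H, DFunLike.coe_injective H.choose_spec]

/-- A Schwartz function, regarded as a tempered distribution. -/
def toDist (φ : 𝓢(ℝ, ℂ)) : 𝓢'(ℝ, ℂ) := SchwartzMap.toTemperedDistributionCLM ℝ ℂ volume φ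

/-- The complex conjugate of a Schwartz function. -/
def conjS (ψ : 𝓢(ℝ, ℂ)) : 𝓢(ℝ, ℂ) :=
  SchwartzMap.postcompCLM (𝕜 := ℝ) (Complex.conjCLE : ℂ →L[ℝ] ℂ) ψ

theorem conjS_apply (ψ : 𝓢(ℝ, ℂ)) (z : ℝ) : conjS ψ z = conj (ψ z) := rfl

/-- The convolution of the reflected conjugate of `ψ` with the tempered distribution `η`, as a
function: `w ↦ ∫ conj (ψ (-(w - z))) η(z) dz`. -/
def reflConv (ψ : 𝓢(ℝ, ℂ)) (η : 𝓢'(ℝ, ℂ)) (w : ℝ) : ℂ :=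
  η ((conjS ψ).compSubConstCLM ℂ w)

/-! ### Admissibility -/

/-- `K` is the value of
`(2π)^(m-1) (∫_{Ω \ 0} + ∫_{ℝ \ Ω}) conj (ψ̂(ζ)) η̂(ζ) / |ζ|^m dζ`,
where `η̂` is a locally integrable function `g` on `Ω \ 0`, for an open neighbourhood `Ω` of `0`,
the integral near `0` is an (absolutely convergent) Lebesgue integral of functions, and the
integral away from `0` is the action of the distribution `η̂`. The two regions are separated by a
smooth cut-off `χ` supported in `Ω` and equal to `1` near `0`; the value does not depend on `Ω`,
`g`, `χ`. -/
def HasAdmissibilityConstant (m : ℕ) (ψ : 𝓢(ℝ, ℂ)) (η : 𝓢'(ℝ, ℂ)) (K : ℂ) : Prop :=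
  ∃ (Ω : Set ℝ) (g : ℝ → ℂ), IsOpen Ω ∧ (0 : ℝ) ∈ Ω ∧
    LocallyIntegrableOn g (Ω \ {0}) ∧
    (∀ φ : 𝓢(ℝ, ℂ), HasCompactSupport φ → tsupport φ ⊆ Ω \ {0} →
      distHat η φ = ∫ ζ, φ ζ * g ζ) ∧
    IntegrableOn (fun ζ : ℝ => conj (fourierHat ψ ζ) * g ζ / ((|ζ| ^ m : ℝ) : ℂ)) (Ω \ {0}) ∧
    ∃ (χ : ℝ → ℝ) (ρ : 𝓢(ℝ, ℂ)), ContDiff ℝ ∞ χ ∧ HasCompactSupport χ ∧ tsupport χ ⊆ Ω ∧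
      (∀ᶠ ζ in 𝓝 0, χ ζ = 1) ∧
      (∀ ζ, ρ ζ = (1 - (χ ζ : ℂ)) * conj (fourierHat ψ ζ) / ((|ζ| ^ m : ℝ) : ℂ)) ∧
      K = (2 * (Real.pi : ℂ)) ^ (m - 1) *
        ((∫ ζ in Ω \ {0},
            (χ ζ : ℂ) * (conj (fourierHat ψ ζ) * g ζ / ((|ζ| ^ m : ℝ) : ℂ))) + distHat η ρ)

/-- `(ψ, η)` is admissible: the constant `K_{ψ,η}` exists and is not zero. -/
def Admissible (m : ℕ) (ψ : 𝓢(ℝ, ℂ)) (η : 𝓢'(ℝ, ℂ)) : Prop :=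
  ∃ K : ℂ, K ≠ 0 ∧ HasAdmissibilityConstant m ψ η K

/-- `ψ` is self-admissible: the pair `(ψ, ψ)` is admissible. -/
def SelfAdmissible (m : ℕ) (ψ : 𝓢(ℝ, ℂ)) : Prop := Admissible m ψ (toDist ψ)

/-- Two admissible pairs are equivalent when they define the same convolution. -/
def EquivalentPairs (m : ℕ) (ψ : 𝓢(ℝ, ℂ)) (η : 𝓢'(ℝ, ℂ)) (ψ' : 𝓢(ℝ, ℂ)) (η' : 𝓢'(ℝ, ℂ)) : Prop :=
  Admissible m ψ η ∧ Admissible m ψ' η' ∧ reflConv ψ η = reflConv ψ' η'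

/-- An admissible pair is admissibly decomposable when it is equivalent to a pair of
self-admissible functions. -/
def AdmissiblyDecomposable (m : ℕ) (ψ : 𝓢(ℝ, ℂ)) (η : 𝓢'(ℝ, ℂ)) : Prop :=
  Admissible m ψ η ∧ ∃ ψs ηs : 𝓢(ℝ, ℂ), SelfAdmissible m ψs ∧ SelfAdmissible m ηs ∧
    EquivalentPairs m ψs (toDist ηs) ψ η

/-! ### Ridgelet transform and truncated dual ridgelet transform -/

/-- The unit sphere of `ℝ^m`. -/
abbrev Sph (m : ℕ) := Metric.sphere (0 : EuclideanSpace ℝ (Fin m)) 1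

/-- The surface measure on the unit sphere (counting measure on `{-1, 1}` when `m = 1`). -/
def surf (m : ℕ) : Measure (Sph m) := (volume : Measure (EuclideanSpace ℝ (Fin m))).toSphere

/-- The Radon transform: the integral of `f` over the hyperplane `p u + (ℝ u)ᗮ`. -/
def radon {m : ℕ} (f : EuclideanSpace ℝ (Fin m) → ℂ) (u : Sph m) (p : ℝ) : ℂ :=
  ∫ y : (Submodule.span ℝ {(u : EuclideanSpace ℝ (Fin m))})ᗮ,
    f (p • (u : EuclideanSpace ℝ (Fin m)) + (y : EuclideanSpace ℝ (Fin m)))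

/-- The ridgelet transform in polar coordinates, `∫ Rf(u, α z + β) conj (ψ z) dz`. -/
def ridgelet {m : ℕ} (ψ : 𝓢(ℝ, ℂ)) (f : EuclideanSpace ℝ (Fin m) → ℂ)
    (u : Sph m) (α β : ℝ) : ℂ :=
  ∫ z : ℝ, radon f u (α * z + β) * conj (ψ z)

/-- The inner integral `∫ T(u, α, β - α z) η(z) dz`, as the action of the distribution `η`. -/
def dualInner {m : ℕ} (η : 𝓢'(ℝ, ℂ)) (T : Sph m → ℝ → ℝ → ℂ) (u : Sph m) (α β : ℝ) : ℂ :=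
  distAction η fun z : ℝ => T u α (β - α * z)

/-- The inner integral `∫ R_ψ f(u, α, β - α z) η(z) dz` in convolution form: the convolution of
`Rf(u, ·)` with the dilation `w ↦ α⁻¹ c(w / α)` of the convolution `c` of the reflected conjugate
of `ψ` with `η`. It makes sense for every integrable `f` when `c` is bounded. -/
def innerConv {m : ℕ} (ψ : 𝓢(ℝ, ℂ)) (η : 𝓢'(ℝ, ℂ)) (f : EuclideanSpace ℝ (Fin m) → ℂ)
    (u : Sph m) (α β : ℝ) : ℂ :=
  ∫ p : ℝ, radon f u p * (reflConv ψ η ((β - p) / α) / (α : ℂ))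

/-- Integration of an inner integral `D(u, α, β)` at `β = u · x` against `α^{-m} dα du` over
`ε < α < δ` and the unit sphere. -/
def truncInt {m : ℕ} (ε δ : ℝ) (D : Sph m → ℝ → ℝ → ℂ) (x : EuclideanSpace ℝ (Fin m)) : ℂ :=
  ∫ u : Sph m, (∫ α in Ioo ε δ,
    D u α ⟪(u : EuclideanSpace ℝ (Fin m)), x⟫ / ((α ^ m : ℝ) : ℂ)) ∂(surf m)

/-- The outer integral in `truncInt` converges absolutely at `x`. -/
def TruncIntegrable {m : ℕ} (ε δ : ℝ) (D : Sph m → ℝ → ℝ → ℂ)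
    (x : EuclideanSpace ℝ (Fin m)) : Prop :=
  Integrable (fun q : Sph m × ℝ =>
      D q.1 q.2 ⟪(q.1 : EuclideanSpace ℝ (Fin m)), x⟫ / ((q.2 ^ m : ℝ) : ℂ))
    ((surf m).prod (volume.restrict (Ioo ε δ)))

/-- The Hilbert space `L²(ℝ^m)`. -/
abbrev L2 (m : ℕ) := Lp ℂ 2 (volume : Measure (EuclideanSpace ℝ (Fin m)))

/-- The bounded operator `I` of `L²(ℝ^m)` is the `(ε, δ)`-truncated reconstruction operator
`f ↦ ∫_{S^{m-1}} ∫_ε^δ ∫ R_ψ f(u, α, u · x - α z) η(z) dz α^{-m} dα du`: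
it extends the explicit formula, with all integrals convergent. For Schwartz functions `f` the
formula is taken literally; for `f ∈ L¹ ∩ L²` the innermost action of `η` is the one given by the
convolution form. -/
structure IsTruncatedReconstruction (m : ℕ) (ψ : 𝓢(ℝ, ℂ)) (η : 𝓢'(ℝ, ℂ)) (ε δ : ℝ)
    (I : L2 m →L[ℂ] L2 m) : Prop where
  schwartz_action : ∀ (f : 𝓢(EuclideanSpace ℝ (Fin m), ℂ)) (u : Sph m) (α β : ℝ), 0 < α →
    ∃ φ : 𝓢(ℝ, ℂ), ∀ z, φ z = ridgelet ψ f u α (β - α * z)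
  schwartz_integrable : ∀ (f : 𝓢(EuclideanSpace ℝ (Fin m), ℂ)) (x : EuclideanSpace ℝ (Fin m)),
    TruncIntegrable ε δ (dualInner η (ridgelet ψ f)) x
  schwartz_eq : ∀ f : 𝓢(EuclideanSpace ℝ (Fin m), ℂ),
    I (f.toLp 2 volume) =ᵐ[volume] truncInt ε δ (dualInner η (ridgelet ψ f))
  conv_inner : ∀ (f : EuclideanSpace ℝ (Fin m) → ℂ), Integrable f →
    ∀ (u : Sph m) (α β : ℝ), 0 < α →
      Integrable fun p : ℝ => radon f u p * (reflConv ψ η ((β - p) / α) / (α : ℂ))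
  conv_integrable : ∀ (f : EuclideanSpace ℝ (Fin m) → ℂ), Integrable f →
    ∀ x : EuclideanSpace ℝ (Fin m), TruncIntegrable ε δ (innerConv ψ η f) x
  conv_eq : ∀ (f : EuclideanSpace ℝ (Fin m) → ℂ), Integrable f →
    ∀ hf : MemLp f 2 volume, I (hf.toLp f) =ᵐ[volume] truncInt ε δ (innerConv ψ η f)

end Ridgelet

end

/-!
The pair enters only through the convolution kernel `c = conj ψ̃ * η`. Since the pair is equivalent
to a pair of Schwartz functions, `c` is itself a Schwartz function
(`AdmissiblyDecomposable.exists_schwartz`).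

The convolution theorem (`distHat_eq_integral`) identifies `conj ψ̂ · η̂` with the Fourier transform
of `c`: the action of `η` is moved through a Bochner integral of translates, after `η` has been
written as a continuous functional of finitely many weighted derivatives, that is, as a functional
on a Banach space of bounded continuous functions (`exists_dist_eq_comp_jet`). Hence, with Mathlib's
normalisation of the Fourier transform `𝓕`, the admissibility constant is the absolutely convergent
integral of `𝓕 c(t) |t|^{-m}` over the line (`HasAdmissibilityConstant.integral_eq`), and it
equals `1`.

By the slice theorem (`fourier_radon`) the inner integral at direction `u` and scale `α` is a
one-dimensional inverse Fourier integral of `s ↦ 𝓕 f (s u) 𝓕 c (α s)`. Integrating over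
`α` and `u` and passing to polar coordinates (`truncInt_innerConv_eq`) shows that the truncated
operator is the Fourier multiplier with symbol
`ξ ↦ ∫ 𝓕 c(t) |t|^{-m} dt` over `ε |ξ| < |t| < δ |ξ|` (`multiplier_eq_setIntegral`).
This symbol is bounded by `∫ |𝓕 c(t)| |t|^{-m} dt`, uniformly in `ε` and `δ`
(`norm_multiplier_le`), and tends to `1` at every `ξ ≠ 0` (`tendsto_multiplier`). Plancherel's
theorem and dominated convergence give the convergence in `L²`
(`tendsto_of_isTruncatedReconstruction`), and the operator is unique because Schwartz functions are
dense (`IsTruncatedReconstruction.unique`).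
-/

noncomputable section
namespace Ridgelet

/-! ### Translates of Schwartz functions and tempered distributions -/

theorem iteratedDeriv_compSubConstCLM (Φ : 𝓢(ℝ, ℂ)) (l : ℕ) (w x : ℝ) :
    iteratedDeriv l (Φ.compSubConstCLM ℂ w) x = iteratedDeriv l Φ (x - w) :=
  congrFun (iteratedDeriv_comp_sub_const l Φ w) x

theorem exists_one_add_pow_mul_iteratedDeriv_le (Φ : 𝓢(ℝ, ℂ)) (k l : ℕ) :
    ∃ C, 0 ≤ C ∧ ∀ x : ℝ, (1 + |x|) ^ k * ‖iteratedDeriv l Φ x‖ ≤ C := by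
  refine ⟨2 ^ k * ((Finset.Iic (k, l)).sup fun m => SchwartzMap.seminorm ℂ m.1 m.2) Φ,
    mul_nonneg (by positivity) (apply_nonneg _ _), fun x => ?_⟩
  have h := SchwartzMap.one_add_le_sup_seminorm_apply (𝕜 := ℂ) (m := (k, l)) le_rfl le_rfl Φ x
  rwa [norm_iteratedFDeriv_eq_norm_iteratedDeriv] at h

theorem exists_seminorm_compSubConstCLM_le (Φ : 𝓢(ℝ, ℂ)) (k l : ℕ) :
    ∃ C, 0 ≤ C ∧ ∀ w : ℝ,
      SchwartzMap.seminorm ℂ k l (Φ.compSubConstCLM ℂ w) ≤ C * (1 + |w|) ^ k := by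
  obtain ⟨C, hC0, hC⟩ := exists_one_add_pow_mul_iteratedDeriv_le Φ k l
  refine ⟨C, hC0, fun w => SchwartzMap.seminorm_le_bound' ℂ k l _ (by positivity) fun x => ?_⟩
  rw [iteratedDeriv_compSubConstCLM]
  have h1 : |x| ≤ (1 + |x - w|) * (1 + |w|) := by
    have := abs_add_le (x - w) w
    rw [sub_add_cancel] at this
    nlinarith [abs_nonneg (x - w), abs_nonneg w]
  calc |x| ^ k * ‖iteratedDeriv l Φ (x - w)‖
      ≤ ((1 + |x - w|) * (1 + |w|)) ^ k * ‖iteratedDeriv l Φ (x - w)‖ := by gcongr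
    _ = ((1 + |x - w|) ^ k * ‖iteratedDeriv l Φ (x - w)‖) * (1 + |w|) ^ k := by
      rw [mul_pow]; ring
    _ ≤ C * (1 + |w|) ^ k := by gcongr; exact hC _

/-- Translation is continuous at `0` in each Schwartz seminorm, by the mean value inequality. -/
theorem exists_seminorm_compSubConstCLM_sub_le (Φ : 𝓢(ℝ, ℂ)) (k l : ℕ) :
    ∃ C, 0 ≤ C ∧ ∀ w : ℝ, |w| ≤ 1 →
      SchwartzMap.seminorm ℂ k l (Φ.compSubConstCLM ℂ w - Φ) ≤ C * |w| := by
  obtain ⟨C, hC0, hC⟩ := exists_one_add_pow_mul_iteratedDeriv_le Φ k (l + 1)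
  refine ⟨2 ^ k * C, by positivity, fun w hw =>
    SchwartzMap.seminorm_le_bound' ℂ k l _ (by positivity) fun x => ?_⟩
  have hsub : iteratedDeriv l (Φ.compSubConstCLM ℂ w - Φ : 𝓢(ℝ, ℂ)) x =
      iteratedDeriv l Φ (x - w) - iteratedDeriv l Φ x := by
    rw [← iteratedDeriv_compSubConstCLM]
    exact iteratedDeriv_sub ((Φ.compSubConstCLM ℂ w).smooth l).contDiffAt
      (Φ.smooth l).contDiffAt
  rw [hsub]
  have hd : ∀ y ∈ segment ℝ x (x - w), HasDerivWithinAt (iteratedDeriv l Φ)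
      (iteratedDeriv (l + 1) Φ y) (segment ℝ x (x - w)) y := fun y _ => by
    rw [iteratedDeriv_succ]
    have : Differentiable ℝ (iteratedDeriv l Φ) :=
      (Φ.smooth (l + 1 : ℕ)).differentiable_iteratedDeriv l (by norm_cast; omega)
    exact (this y).hasDerivAt.hasDerivWithinAt
  have hb : ∀ y ∈ segment ℝ x (x - w),
      ‖(|x| ^ k : ℝ) • iteratedDeriv (l + 1) Φ y‖ ≤ 2 ^ k * C := fun y hy => by
    have hxy : |x - y| ≤ 1 := by
      have h1 : y ∈ Metric.closedBall x 1 :=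
        (convex_closedBall x 1).segment_subset (Metric.mem_closedBall_self zero_le_one)
          (by simpa [Metric.mem_closedBall, Real.dist_eq] using hw) hy
      rw [abs_sub_comm]; simpa [Real.dist_eq] using h1
    have h2 : |x| ≤ 2 * (1 + |y|) := by
      have := abs_add_le (x - y) y
      rw [sub_add_cancel] at this
      linarith [abs_nonneg y]
    rw [norm_smul, Real.norm_of_nonneg (by positivity)]
    calc |x| ^ k * ‖iteratedDeriv (l + 1) Φ y‖
        ≤ (2 * (1 + |y|)) ^ k * ‖iteratedDeriv (l + 1) Φ y‖ := by gcongr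
      _ = 2 ^ k * ((1 + |y|) ^ k * ‖iteratedDeriv (l + 1) Φ y‖) := by rw [mul_pow]; ring
      _ ≤ _ := by gcongr; exact hC _
  have := Convex.norm_image_sub_le_of_norm_hasDerivWithin_le
    (fun y hy => (hd y hy).const_smul (|x| ^ k : ℝ)) hb (convex_segment x (x - w))
    (left_mem_segment ℝ _ _) (right_mem_segment ℝ _ _)
  simp only [Pi.smul_apply, ← smul_sub, norm_smul, norm_pow, Real.norm_eq_abs, abs_abs] at this
  simpa using this

theorem continuous_compSubConstCLM (Φ : 𝓢(ℝ, ℂ)) :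
    Continuous fun w : ℝ => Φ.compSubConstCLM ℂ w := by
  have h0 : Tendsto (fun w : ℝ => Φ.compSubConstCLM ℂ w) (𝓝 0) (𝓝 Φ) := by
    rw [(schwartz_withSeminorms ℂ ℝ ℂ).tendsto_nhds _ _]
    rintro ⟨k, l⟩ e he
    obtain ⟨C, hC0, hC⟩ := exists_seminorm_compSubConstCLM_sub_le Φ k l
    have h1 : ∀ᶠ w : ℝ in 𝓝 0, |w| < 1 ∧ C * |w| < e := by
      refine ((continuous_abs.tendsto' (0 : ℝ) 0 abs_zero).eventually (gt_mem_nhds one_pos)).and ?_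
      have : Tendsto (fun w : ℝ => C * |w|) (𝓝 0) (𝓝 0) :=
        Continuous.tendsto' (by fun_prop) _ _ (by simp)
      exact this.eventually (gt_mem_nhds he)
    filter_upwards [h1] with w hw
    exact (hC w hw.1.le).trans_lt hw.2
  rw [continuous_iff_continuousAt]
  intro w
  have h2 : (fun v : ℝ => Φ.compSubConstCLM ℂ v) =
      fun v => (Φ.compSubConstCLM ℂ (v - w)).compSubConstCLM ℂ w := by
    ext v x
    simp [SchwartzMap.compSubConstCLM_apply]
  rw [ContinuousAt, h2]
  refine ((SchwartzMap.compSubConstCLM ℂ w).continuous.tendsto Φ).comp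
    (h0.comp (Continuous.tendsto' (by fun_prop) _ _ (sub_self w)))

theorem exists_norm_dist_le (η : 𝓢'(ℝ, ℂ)) :
    ∃ (s : Finset (ℕ × ℕ)) (C : ℝ), 0 ≤ C ∧
      ∀ φ : 𝓢(ℝ, ℂ), ‖η φ‖ ≤ C * (s.sup (schwartzSeminormFamily ℂ ℝ ℂ)) φ := by
  have hc : Continuous fun φ : 𝓢(ℝ, ℂ) => η φ := map_continuous η
  obtain ⟨s, C, -, h⟩ := Seminorm.bound_of_continuous (schwartz_withSeminorms ℂ ℝ ℂ)
    ((normSeminorm ℂ ℂ).comp (η : 𝓢(ℝ, ℂ) →ₗ[ℂ] ℂ)) (by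
      exact continuous_norm.comp hc)
  exact ⟨s, C, C.2, fun φ => h φ⟩

theorem continuous_dist_compSubConstCLM (η : 𝓢'(ℝ, ℂ)) (Φ : 𝓢(ℝ, ℂ)) :
    Continuous fun w : ℝ => η (Φ.compSubConstCLM ℂ w) :=
  (map_continuous η).comp (continuous_compSubConstCLM Φ)

theorem exists_norm_dist_compSubConstCLM_le (η : 𝓢'(ℝ, ℂ)) (Φ : 𝓢(ℝ, ℂ)) :
    ∃ (N : ℕ) (C : ℝ), 0 ≤ C ∧ ∀ w : ℝ, ‖η (Φ.compSubConstCLM ℂ w)‖ ≤ C * (1 + |w|) ^ N := by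
  obtain ⟨s, C, hC0, hC⟩ := exists_norm_dist_le η
  choose D hD0 hD using exists_seminorm_compSubConstCLM_le Φ
  refine ⟨s.sup Prod.fst, C * ∑ i ∈ s, D i.1 i.2,
    mul_nonneg hC0 (Finset.sum_nonneg fun i _ => hD0 _ _), fun w => (hC _).trans ?_⟩
  rw [mul_assoc]
  refine mul_le_mul_of_nonneg_left ?_ hC0
  refine Seminorm.finset_sup_apply_le (mul_nonneg (Finset.sum_nonneg fun i _ => hD0 _ _)
    (by positivity)) fun i hi => (hD i.1 i.2 w).trans ?_
  have h1 : D i.1 i.2 ≤ ∑ i ∈ s, D i.1 i.2 :=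
    Finset.single_le_sum (f := fun i : ℕ × ℕ => D i.1 i.2) (fun i _ => hD0 _ _) hi
  have h2 : (1 + |w|) ^ i.1 ≤ (1 + |w|) ^ (s.sup Prod.fst) :=
    pow_le_pow_right₀ (by linarith [abs_nonneg w]) (Finset.le_sup (f := Prod.fst) hi)
  exact mul_le_mul h1 h2 (by positivity) (Finset.sum_nonneg fun i _ => hD0 _ _)

theorem integrable_mul_of_polynomial_growth (θ : 𝓢(ℝ, ℂ)) {F : ℝ → ℂ} (hF : Continuous F) {N : ℕ}
    {C : ℝ} (hC : ∀ w, ‖F w‖ ≤ C * (1 + |w|) ^ N) : Integrable fun w => θ w * F w := by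
  have h1 : Integrable fun w : ℝ => C * ((2 : ℝ) ^ N * (‖θ w‖ + |w| ^ N * ‖θ w‖)) := by
    refine ((θ.integrable.norm.add ?_).const_mul _).const_mul _
    simpa using θ.integrable_pow_mul volume N
  refine h1.mono' (by fun_prop) (ae_of_all _ fun w => ?_)
  have hC0 : 0 ≤ C := by simpa using (norm_nonneg _).trans (hC 0)
  have h2 : (1 + |w|) ^ N ≤ 2 ^ N * (1 + |w| ^ N) := by
    have h3 := add_pow_le (zero_le_one (α := ℝ)) (abs_nonneg w) N
    rw [one_pow] at h3
    refine h3.trans (mul_le_mul_of_nonneg_right ?_ (by positivity))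
    exact pow_le_pow_right₀ (by norm_num) (Nat.sub_le _ _)
  calc ‖θ w * F w‖ = ‖θ w‖ * ‖F w‖ := norm_mul _ _
    _ ≤ ‖θ w‖ * (C * (2 ^ N * (1 + |w| ^ N))) := by
        gcongr; exact (hC w).trans (by gcongr)
    _ = _ := by ring

/-- The functions `x ↦ x ^ k φ⁽ˡ⁾(x)` for `(k, l)` in a finite set: a continuous linear map into a
Banach space through which a tempered distribution factors. -/
def jet (s : Finset (ℕ × ℕ)) : 𝓢(ℝ, ℂ) →L[ℂ] (s → BoundedContinuousFunction ℝ ℂ) :=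
  ContinuousLinearMap.pi fun i => (SchwartzMap.toBoundedContinuousFunctionCLM ℂ ℝ ℂ).comp
    ((SchwartzMap.smulLeftCLM ℂ fun x : ℝ => (x : ℂ) ^ i.1.1).comp
      ((SchwartzMap.derivCLM ℂ ℂ) ^ i.1.2))

theorem derivCLM_pow_apply (l : ℕ) (φ : 𝓢(ℝ, ℂ)) :
    ⇑(((SchwartzMap.derivCLM ℂ ℂ) ^ l : 𝓢(ℝ, ℂ) →L[ℂ] 𝓢(ℝ, ℂ)) φ) = iteratedDeriv l φ := by
  induction l with
  | zero => simp
  | succ l ih =>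
    rw [pow_succ', iteratedDeriv_succ, ← ih]
    ext x
    simp

theorem jet_apply (s : Finset (ℕ × ℕ)) (φ : 𝓢(ℝ, ℂ)) (i : s) (x : ℝ) :
    jet s φ i x = (x : ℂ) ^ i.1.1 * iteratedDeriv i.1.2 φ x := by
  rw [← derivCLM_pow_apply]
  have h : Function.HasTemperateGrowth fun x : ℝ => (x : ℂ) ^ i.1.1 :=
    Function.Complex.hasTemperateGrowth_ofReal.pow _
  simp [jet, SchwartzMap.smulLeftCLM_apply_apply h]

theorem seminorm_le_norm_jet (s : Finset (ℕ × ℕ)) (φ : 𝓢(ℝ, ℂ)) :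
    (s.sup (schwartzSeminormFamily ℂ ℝ ℂ)) φ ≤ ‖jet s φ‖ := by
  refine Seminorm.finset_sup_apply_le (norm_nonneg _) fun i hi => ?_
  refine SchwartzMap.seminorm_le_bound' ℂ i.1 i.2 φ (norm_nonneg _) fun x => ?_
  have h := ((jet s φ ⟨i, hi⟩).norm_coe_le_norm x).trans (norm_le_pi_norm (jet s φ) ⟨i, hi⟩)
  simpa [jet_apply] using h

/-- A tempered distribution is the restriction of a continuous functional on a Banach space. -/
theorem exists_dist_eq_comp_jet (η : 𝓢'(ℝ, ℂ)) :
    ∃ (s : Finset (ℕ × ℕ)) (Λ : StrongDual ℂ (s → BoundedContinuousFunction ℝ ℂ)),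
      ∀ φ, η φ = Λ (jet s φ) := by
  obtain ⟨s₀, C, hC0, hC⟩ := exists_norm_dist_le η
  -- The index `(0, 0)` makes the jet injective.
  let s := insert (0, 0) s₀
  have hinj : Function.Injective (jet s) := fun φ φ' h => by
    ext x
    have := DFunLike.congr_fun (congrFun h ⟨(0, 0), Finset.mem_insert_self _ _⟩) x
    simpa [jet_apply] using this
  let e := LinearEquiv.ofInjective (jet s).toLinearMap (by exact hinj)
  let f : StrongDual ℂ (LinearMap.range (jet s).toLinearMap) :=
    LinearMap.mkContinuous ((η : 𝓢(ℝ, ℂ) →ₗ[ℂ] ℂ) ∘ₗ (e.symm : _ →ₗ[ℂ] 𝓢(ℝ, ℂ))) C fun y => by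
      obtain ⟨φ, rfl⟩ := e.surjective y
      have h1 : ‖e φ‖ = ‖jet s φ‖ := rfl
      rw [h1]
      change ‖η (e.symm (e φ))‖ ≤ _
      rw [e.symm_apply_apply]
      refine (hC φ).trans (mul_le_mul_of_nonneg_left ?_ hC0)
      refine le_trans ?_ (seminorm_le_norm_jet s φ)
      exact Finset.sup_mono (f := schwartzSeminormFamily ℂ ℝ ℂ) (Finset.subset_insert _ _) φ
  obtain ⟨Λ, hΛ, -⟩ := exists_extension_norm_eq _ f
  refine ⟨s, Λ, fun φ => ?_⟩
  have h2 := hΛ (e φ)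
  have h3 : f (e φ) = η φ := by
    change η (e.symm (e φ)) = _
    rw [e.symm_apply_apply]
  rw [← h3, ← h2]
  rfl

/-- All derivatives of a convolution of Schwartz functions fall on one factor. -/
theorem iteratedDeriv_eq_integral (l : ℕ) : ∀ (θ Φ Θ : 𝓢(ℝ, ℂ)),
    (∀ x, Θ x = ∫ w, θ w * Φ (x - w)) → ∀ x, iteratedDeriv l Θ x =
      ∫ w, θ w * iteratedDeriv l Φ (x - w) := by
  induction l with
  | zero => intro θ Φ Θ h x; simpa using h x
  | succ l ih =>
    intro θ Φ Θ h x
    have h1 := ih θ (SchwartzMap.derivCLM ℂ ℂ Φ) (SchwartzMap.derivCLM ℂ ℂ Θ) (fun y => ?_) x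
    · simpa only [iteratedDeriv_succ', SchwartzMap.derivCLM_apply, funext_iff,
        show ⇑(SchwartzMap.derivCLM ℂ ℂ Φ) = deriv Φ from rfl,
        show ⇑(SchwartzMap.derivCLM ℂ ℂ Θ) = deriv Θ from rfl] using h1
    · obtain ⟨C, hC0, hC⟩ := exists_one_add_pow_mul_iteratedDeriv_le Φ 0 1
      obtain ⟨C', hC0', hC'⟩ := exists_one_add_pow_mul_iteratedDeriv_le Φ 0 0
      simp only [pow_zero, one_mul, iteratedDeriv_one, iteratedDeriv_zero] at hC hC'
      have hcd : Continuous (deriv Φ) := (SchwartzMap.derivCLM ℂ ℂ Φ).continuous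
      have h2 := (hasDerivAt_integral_of_dominated_loc_of_deriv_le (μ := volume) (x₀ := y)
        (F := fun y w => θ w * Φ (y - w)) (F' := fun y w => θ w * deriv Φ (y - w))
        (bound := fun w => ‖θ w‖ * C) (s := univ) univ_mem
        (Eventually.of_forall fun y => by fun_prop)
        ((θ.integrable.norm.mul_const C').mono' (by fun_prop) (ae_of_all _ fun w => by
          rw [norm_mul]; gcongr; exact hC' _))
        (by fun_prop)
        (ae_of_all _ fun w y _ => by rw [norm_mul]; gcongr; exact hC _)
        (θ.integrable.norm.mul_const C)
        (ae_of_all _ fun w y _ => by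
          have := ((Φ.differentiableAt (x := y - w)).hasDerivAt.comp_sub_const y w)
          exact this.const_mul _)).2
      rw [SchwartzMap.derivCLM_apply, show (Θ : ℝ → ℂ) = fun x => ∫ w, θ w * Φ (x - w) from
        funext h, h2.deriv]
      rfl

/-- A tempered distribution may be interchanged with the integral defining the convolution of two
Schwartz functions. -/
theorem dist_convolution_eq_integral (η : 𝓢'(ℝ, ℂ)) (θ Φ Θ : 𝓢(ℝ, ℂ))
    (h : ∀ x, Θ x = ∫ w, θ w * Φ (x - w)) :
    η Θ = ∫ w, θ w * η (Φ.compSubConstCLM ℂ w) := by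
  obtain ⟨s, Λ, hΛ⟩ := exists_dist_eq_comp_jet η
  have hcont : Continuous fun w : ℝ => jet s (Φ.compSubConstCLM ℂ w) :=
    (jet s).continuous.comp (continuous_compSubConstCLM Φ)
  -- The jets of the translates grow polynomially, so that their integral against `θ` is a Bochner
  -- integral.
  have hint : Integrable fun w => θ w • jet s (Φ.compSubConstCLM ℂ w) := by
    choose D hD0 hD using exists_one_add_pow_mul_iteratedDeriv_le Φ
    let N := s.sup Prod.fst
    let C := ∑ i ∈ s, D i.1 i.2
    have hb : ∀ w : ℝ, ‖jet s (Φ.compSubConstCLM ℂ w)‖ ≤ C * (1 + |w|) ^ N := fun w => by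
      have hCn : 0 ≤ C := Finset.sum_nonneg fun i _ => hD0 _ _
      refine (pi_norm_le_iff_of_nonneg (by positivity)).2 fun i =>
        (BoundedContinuousFunction.norm_le (by positivity)).2 fun x => ?_
      rw [jet_apply, iteratedDeriv_compSubConstCLM, norm_mul, norm_pow, Complex.norm_real,
        Real.norm_eq_abs]
      have h1 : |x| ≤ (1 + |x - w|) * (1 + |w|) := by
        have := abs_add_le (x - w) w
        rw [sub_add_cancel] at this
        nlinarith [abs_nonneg (x - w), abs_nonneg w]
      calc |x| ^ i.1.1 * ‖iteratedDeriv i.1.2 Φ (x - w)‖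
          ≤ ((1 + |x - w|) * (1 + |w|)) ^ i.1.1 * ‖iteratedDeriv i.1.2 Φ (x - w)‖ := by gcongr
        _ = ((1 + |x - w|) ^ i.1.1 * ‖iteratedDeriv i.1.2 Φ (x - w)‖) * (1 + |w|) ^ i.1.1 := by
          rw [mul_pow]; ring
        _ ≤ C * (1 + |w|) ^ N := by
          refine mul_le_mul ((hD _ _ _).trans ?_) ?_ (by positivity) hCn
          · exact Finset.single_le_sum (f := fun i : ℕ × ℕ => D i.1 i.2)
              (fun i _ => hD0 _ _) i.2
          · exact pow_le_pow_right₀ (by linarith [abs_nonneg w])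
              (Finset.le_sup (f := Prod.fst) i.2)
    have hb' : Integrable fun w => θ w * ((C * (1 + |w|) ^ N : ℝ) : ℂ) := by
      refine integrable_mul_of_polynomial_growth θ (by fun_prop) (N := N) (C := C) fun w => ?_
      rw [Complex.norm_real, Real.norm_of_nonneg]
      exact (norm_nonneg _).trans (hb w)
    have := secondCountableTopologyEither_of_left ℝ (s → BoundedContinuousFunction ℝ ℂ)
    refine hb'.norm.mono' (θ.continuous.smul hcont).aestronglyMeasurable (ae_of_all _ fun w => ?_)
    rw [norm_smul, norm_mul, Complex.norm_real, Real.norm_of_nonneg ((norm_nonneg _).trans (hb w))]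
    gcongr
    exact hb w
  -- Point evaluations commute with the Bochner integral and identify it with the jet of `Θ`.
  have hjet : jet s Θ = ∫ w, θ w • jet s (Φ.compSubConstCLM ℂ w) := by
    ext i x
    let ev : (s → BoundedContinuousFunction ℝ ℂ) →L[ℂ] ℂ :=
      (BoundedContinuousFunction.evalCLM ℂ x).comp (ContinuousLinearMap.proj i)
    have hev : ∀ g, ev g = g i x := fun g => rfl
    rw [← hev (∫ w, θ w • jet s (Φ.compSubConstCLM ℂ w)), ← ev.integral_comp_comm hint, jet_apply,
      iteratedDeriv_eq_integral _ θ Φ Θ h, ← integral_const_mul]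
    congr 1
    ext w
    rw [map_smul, hev, jet_apply, iteratedDeriv_compSubConstCLM, smul_eq_mul]
    ring
  rw [hΛ, hjet, ← Λ.integral_comp_comm hint]
  simp only [map_smul, smul_eq_mul, hΛ]

/-! ### The convolution theorem for a tempered distribution -/

theorem fourier_real_apply (f : ℝ → ℂ) (w : ℝ) :
    𝓕 f w = ∫ v : ℝ, Complex.exp (((-2 * Real.pi * v * w : ℝ) : ℂ) * Complex.I) * f v := by
  rw [Real.fourier_real_eq_integral_exp_smul]; rfl

theorem fourierInv_real_apply (f : ℝ → ℂ) (w : ℝ) :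
    𝓕⁻ f w = ∫ v : ℝ, Complex.exp (((2 * Real.pi * v * w : ℝ) : ℂ) * Complex.I) * f v := by
  rw [Real.fourierInv_eq']
  simp only [smul_eq_mul]
  congr 1; ext v; congr 3
  simp; ring

theorem fourier_comp_const_sub (Ξ : 𝓢(ℝ, ℂ)) (x ξ : ℝ) :
    𝓕 (fun w : ℝ => 𝓕 (Ξ : ℝ → ℂ) (x - w)) ξ =
      Complex.exp (((-2 * Real.pi * ξ * x : ℝ) : ℂ) * Complex.I) * Ξ ξ := by
  have h1 : Ξ ξ = 𝓕⁻ (𝓕 (Ξ : ℝ → ℂ)) ξ := by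
    rw [← SchwartzMap.fourier_coe, ← SchwartzMap.fourierInv_coe]; simp
  rw [h1, fourierInv_real_apply, fourier_real_apply, ← integral_const_mul,
    ← integral_sub_left_eq_self _ volume x]
  congr 1; ext w
  rw [← mul_assoc, ← Complex.exp_add, sub_sub_cancel]
  congr 2
  push_cast; ring

theorem fourier_mul_eq_convolution (b Ξ Θ : 𝓢(ℝ, ℂ)) (h : ∀ ξ, Θ ξ = b ξ * Ξ ξ) (x : ℝ) :
    𝓕 Θ x = ∫ w, 𝓕 b w * 𝓕 Ξ (x - w) := by
  let g : 𝓢(ℝ, ℂ) := SchwartzMap.compCLMOfContinuousLinearEquiv ℂ (ContinuousLinearEquiv.neg ℝ)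
    ((𝓕 Ξ).compSubConstCLM ℂ (-x))
  have hg : ∀ w, g w = 𝓕 Ξ (x - w) := fun w => by
    change 𝓕 Ξ (-w - -x) = _
    congr 1; ring
  have h1 := SchwartzMap.integral_fourier_mul_eq b g
  simp only [hg] at h1
  rw [h1, SchwartzMap.fourier_coe, SchwartzMap.fourier_coe, fourier_real_apply]
  congr 1; ext ξ
  rw [show (g : ℝ → ℂ) = fun w : ℝ => 𝓕 (Ξ : ℝ → ℂ) (x - w) from funext hg,
    fourier_comp_const_sub, h]
  ring_nf

/-- The Fourier transform of a product is a convolution, and `η` is moved inside it. -/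
theorem dist_fourier_mul (η : 𝓢'(ℝ, ℂ)) (b Ξ Θ : 𝓢(ℝ, ℂ)) (h : ∀ ξ, Θ ξ = b ξ * Ξ ξ) :
    η (𝓕 Θ) = ∫ w, 𝓕 b w * η ((𝓕 Ξ).compSubConstCLM ℂ w) :=
  dist_convolution_eq_integral η _ _ _ (fourier_mul_eq_convolution b Ξ Θ h)

theorem integral_fourier_dilate_mul (b b' : 𝓢(ℝ, ℂ)) {t : ℝ} (ht : 0 < t)
    (h : ∀ ξ, b' ξ = b (t * ξ)) (F : ℝ → ℂ) :
    ∫ w, 𝓕 b' w * F w = ∫ v, 𝓕 b v * F (t * v) := by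
  have h1 := Measure.integral_comp_mul_left (fun w => 𝓕 b' w * F w) t
  have h2 : ∀ v, 𝓕 b' (t * v) = (t⁻¹ : ℝ) • 𝓕 b v := fun v => by
    rw [SchwartzMap.fourier_coe, SchwartzMap.fourier_coe, fourier_real_apply, fourier_real_apply]
    have h3 := Measure.integral_comp_mul_left (fun w : ℝ =>
      Complex.exp (((-2 * Real.pi * w * v : ℝ) : ℂ) * Complex.I) * b w) t
    rw [abs_of_pos (inv_pos.2 ht)] at h3
    rw [← h3]
    congr 1; ext w
    rw [h, show -2 * Real.pi * w * (t * v) = -2 * Real.pi * (t * w) * v by ring]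
  simp only [h2, smul_mul_assoc] at h1
  rw [integral_smul, abs_of_pos (inv_pos.2 ht)] at h1
  exact (smul_right_injective ℂ (inv_pos.2 ht).ne' h1).symm

/-- If the convolution of `η` with the reflected conjugate of `ψ` is a Schwartz function `c`, then
`conj ψ̂ · η̂ = ĉ`, tested against smooth functions `n` that need not be Schwartz: the action on
`n` is obtained by testing against dilates of a cut-off function. -/
theorem dist_fourier_eq_integral {ψ : 𝓢(ℝ, ℂ)} {η : 𝓢'(ℝ, ℂ)} {c : 𝓢(ℝ, ℂ)}
    (hc : ∀ w, reflConv ψ η w = c w) {n : ℝ → ℂ} (hn : ContDiff ℝ ∞ n) {Ξ : 𝓢(ℝ, ℂ)}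
    (hΞ : ∀ ξ, Ξ ξ = n ξ * 𝓕⁻ (conjS ψ) ξ) (hint : Integrable fun ξ => n ξ * 𝓕 c ξ) :
    η (𝓕 Ξ) = ∫ ξ, n ξ * 𝓕 c ξ := by
  -- a cut-off function and its dilates
  let χ : ContDiffBump (0 : ℝ) := ⟨1, 2, one_pos, one_lt_two⟩
  have hχs : ∀ t : ℝ, 0 < t → HasCompactSupport fun ξ : ℝ => ((χ (t * ξ) : ℝ) : ℂ) := fun t ht => by
    have h1 : HasCompactSupport fun ξ : ℝ => χ (t * ξ) :=
      χ.hasCompactSupport.comp_homeomorph (Homeomorph.mulLeft₀ t ht.ne')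
    exact h1.comp_left (g := ((↑) : ℝ → ℂ)) Complex.ofReal_zero
  have hχd : ∀ t : ℝ, ContDiff ℝ ∞ fun ξ : ℝ => ((χ (t * ξ) : ℝ) : ℂ) := fun t =>
    Complex.ofRealCLM.contDiff.comp (χ.contDiff.comp (contDiff_const.mul contDiff_id))
  let b : ∀ t : ℝ, 0 < t → 𝓢(ℝ, ℂ) := fun t ht => (hχs t ht).toSchwartzMap (hχd t)
  have hb : ∀ t ht ξ, b t ht ξ = ((χ (t * ξ) : ℝ) : ℂ) := fun t ht ξ => rfl
  let F : ℝ → ℂ := fun w => η ((𝓕 Ξ).compSubConstCLM ℂ w)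
  have hF : Continuous F := continuous_dist_compSubConstCLM η _
  have hF0 : F 0 = η (𝓕 Ξ) := by simp [F]
  -- The product of `Ξ` with a dilated cut-off `b t` is both `b t · Ξ` and
  -- `(b t · n) · 𝓕⁻ (conj ψ)`; for the second splitting the translates give the values of `c`.
  have key : ∀ t ht, ∫ v, 𝓕 (b 1 one_pos) v * F (t * v) = ∫ ξ, b t ht ξ * (n ξ * 𝓕 c ξ) := by
    intro t ht
    have hβs : HasCompactSupport fun ξ => ((χ (t * ξ) : ℝ) : ℂ) * n ξ := (hχs t ht).mul_right
    let β : 𝓢(ℝ, ℂ) := hβs.toSchwartzMap ((hχd t).mul hn)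
    have hβ : ∀ ξ, β ξ = b t ht ξ * n ξ := fun ξ => rfl
    let Θ : 𝓢(ℝ, ℂ) := SchwartzMap.pairing (ContinuousLinearMap.mul ℂ ℂ) (b t ht) Ξ
    have h1 : η (𝓕 Θ) = ∫ w, 𝓕 (b t ht) w * F w :=
      dist_fourier_mul η (b t ht) Ξ Θ fun ξ => rfl
    have h2 : η (𝓕 Θ) = ∫ w, 𝓕 β w * η ((𝓕 (𝓕⁻ (conjS ψ))).compSubConstCLM ℂ w) :=
      dist_fourier_mul η β (𝓕⁻ (conjS ψ)) Θ fun ξ => by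
        rw [hβ, mul_assoc, ← hΞ]; rfl
    have h3 : ∀ w, η ((𝓕 (𝓕⁻ (conjS ψ))).compSubConstCLM ℂ w) = c w := fun w => by
      rw [FourierTransform.fourier_fourierInv_eq]; exact hc w
    simp only [h3] at h2
    rw [SchwartzMap.integral_fourier_mul_eq] at h2
    rw [← integral_fourier_dilate_mul (b 1 one_pos) (b t ht) ht (fun ξ => by
      rw [hb t ht, hb 1 one_pos, one_mul]) F, ← h1, h2]
    congr 1; ext ξ
    rw [hβ]; ring
  -- Both sides converge as the dilation parameter tends to `0`: on the left `𝓕 (b t)` is an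
  -- approximate identity and `F` has polynomial growth, on the right `b t` tends to `1`.
  have ht0 : Tendsto (fun k : ℕ => 1 / ((k : ℝ) + 1)) atTop (𝓝 0) :=
    tendsto_one_div_add_atTop_nhds_zero_nat
  have hL : Tendsto (fun k : ℕ => ∫ v, 𝓕 (b 1 one_pos) v * F (1 / ((k : ℝ) + 1) * v)) atTop
      (𝓝 (∫ v, 𝓕 (b 1 one_pos) v * F 0)) := by
    obtain ⟨N, C, hC0, hC⟩ := exists_norm_dist_compSubConstCLM_le η (𝓕 Ξ)
    have hbound : Integrable fun v : ℝ => 𝓕 (b 1 one_pos) v * ((C * (1 + |v|) ^ N : ℝ) : ℂ) :=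
      integrable_mul_of_polynomial_growth _ (by fun_prop) (N := N) (C := C) fun w => by
        rw [Complex.norm_real, Real.norm_of_nonneg (by positivity)]
    refine tendsto_integral_of_dominated_convergence _ (fun k => by fun_prop) hbound.norm
      (fun k => ae_of_all _ fun v => ?_) (ae_of_all _ fun v => ?_)
    · rw [norm_mul, norm_mul, Complex.norm_real, Real.norm_of_nonneg (by positivity)]
      gcongr
      refine (hC _).trans ?_
      have hv : |1 / ((k : ℝ) + 1) * v| ≤ |v| := by
        rw [abs_mul, abs_of_pos (by positivity : 0 < 1 / ((k : ℝ) + 1))]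
        refine mul_le_of_le_one_left (abs_nonneg v) ?_
        rw [div_le_one (by positivity)]; linarith [k.cast_nonneg (α := ℝ)]
      gcongr
    · refine ((hF.tendsto 0).comp ?_).const_mul _
      simpa using ht0.mul_const v
  have hR : Tendsto (fun k : ℕ => ∫ ξ, ((χ (1 / ((k : ℝ) + 1) * ξ) : ℝ) : ℂ) * (n ξ * 𝓕 c ξ)) atTop
      (𝓝 (∫ ξ, ((χ 0 : ℝ) : ℂ) * (n ξ * 𝓕 c ξ))) := by
    refine tendsto_integral_of_dominated_convergence _
      (fun k => (hχd _).continuous.aestronglyMeasurable.mul hint.aestronglyMeasurable) hint.norm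
      (fun k => ae_of_all _ fun v => ?_) (ae_of_all _ fun v => ?_)
    · rw [norm_mul, Complex.norm_real, Real.norm_of_nonneg χ.nonneg]
      exact mul_le_of_le_one_left (norm_nonneg _) χ.le_one
    · refine Tendsto.mul_const _ ?_
      refine ((Complex.continuous_ofReal.comp χ.continuous).tendsto 0).comp ?_
      simpa using ht0.mul_const v
  have hχ0 : χ 0 = 1 := χ.one_of_mem_closedBall (Metric.mem_closedBall_self zero_le_one)
  have hI : ∫ v, 𝓕 (b 1 one_pos) v = 1 := by
    have h1 : 𝓕⁻ (𝓕 (b 1 one_pos)) 0 = b 1 one_pos 0 := by simp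
    rw [SchwartzMap.fourierInv_coe, fourierInv_real_apply, hb 1 one_pos, mul_zero, hχ0] at h1
    simpa using h1
  rw [integral_mul_const, hI, one_mul, hF0] at hL
  simp only [hχ0, Complex.ofReal_one, one_mul] at hR
  refine tendsto_nhds_unique hL (hR.congr fun k => ?_)
  exact (key _ (by positivity)).symm

theorem fourierHat_eq (φ : 𝓢(ℝ, ℂ)) (ζ : ℝ) :
    fourierHat φ ζ = 𝓕 φ (ζ * (2 * Real.pi)⁻¹) := rfl

theorem fourierInv_conjS (ψ : 𝓢(ℝ, ℂ)) (ξ : ℝ) :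
    𝓕⁻ (conjS ψ) ξ = conj (fourierHat ψ (2 * Real.pi * ξ)) := by
  have hp : (2 * Real.pi) ≠ 0 := by positivity
  rw [fourierHat_eq, mul_right_comm, mul_inv_cancel₀ hp, one_mul, SchwartzMap.fourierInv_coe,
    SchwartzMap.fourier_coe, fourierInv_real_apply, fourier_real_apply, ← integral_conj]
  congr 1; ext v
  rw [map_mul, ← Complex.exp_conj, conjS_apply, map_mul, Complex.conj_I, Complex.conj_ofReal]
  congr 2
  push_cast; ring

/-- `conj ψ̂ · η̂ = ĉ` in the normalisation `∫ f(x) e^{-i x ζ} dx`. -/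
theorem distHat_eq_integral {ψ : 𝓢(ℝ, ℂ)} {η : 𝓢'(ℝ, ℂ)} {c : 𝓢(ℝ, ℂ)}
    (hc : ∀ w, reflConv ψ η w = c w) {a : ℝ → ℂ} (ha : ContDiff ℝ ∞ a) {ρ : 𝓢(ℝ, ℂ)}
    (hρ : ∀ ζ, ρ ζ = a ζ * conj (fourierHat ψ ζ))
    (hint : Integrable fun ζ => a ζ * fourierHat c ζ) :
    distHat η ρ = ∫ ζ, a ζ * fourierHat c ζ := by
  have hp : (0 : ℝ) < 2 * Real.pi := by positivity
  let e : ℝ ≃L[ℝ] ℝ := ContinuousLinearEquiv.unitsEquivAut ℝ (Units.mk0 (2 * Real.pi) hp.ne')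
  have he : ∀ ξ, e ξ = 2 * Real.pi * ξ := fun ξ => by
    change ξ * (2 * Real.pi) = _; ring
  let Ξ : 𝓢(ℝ, ℂ) := (2 * Real.pi : ℂ) • SchwartzMap.compCLMOfContinuousLinearEquiv ℂ e ρ
  have hΞ : ∀ ξ, Ξ ξ = (2 * Real.pi : ℂ) * ρ (2 * Real.pi * ξ) := fun ξ => by
    rw [← he]; rfl
  have hcξ : ∀ ξ, fourierHat c (2 * Real.pi * ξ) = 𝓕 c ξ := fun ξ => by
    rw [fourierHat_eq, mul_right_comm, mul_inv_cancel₀ hp.ne', one_mul]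
  have h1 : fourierHat ρ = 𝓕 Ξ := by
    ext ζ
    rw [fourierHat_eq, SchwartzMap.fourier_coe, SchwartzMap.fourier_coe, fourier_real_apply,
      fourier_real_apply]
    have h2 := Measure.integral_comp_mul_left (fun v : ℝ =>
      Complex.exp (((-2 * Real.pi * v * (ζ * (2 * Real.pi)⁻¹) : ℝ) : ℂ) * Complex.I) * ρ v)
      (2 * Real.pi)
    rw [abs_of_pos (inv_pos.2 hp), eq_inv_smul_iff₀ hp.ne'] at h2
    rw [← h2, ← integral_smul]
    congr 1; ext v
    rw [hΞ, Complex.real_smul]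
    have : -2 * Real.pi * (2 * Real.pi * v) * (ζ * (2 * Real.pi)⁻¹) = -2 * Real.pi * v * ζ := by
      field_simp
    rw [this]; push_cast; ring
  have h3 : ∀ ξ, a (2 * Real.pi * ξ) * fourierHat c (2 * Real.pi * ξ) =
    a (2 * Real.pi * ξ) * 𝓕 c ξ := fun ξ => by rw [hcξ]
  have hint' := (hint.comp_mul_left' hp.ne').const_mul (2 * Real.pi : ℂ)
  rw [distHat, h1, dist_fourier_eq_integral hc
    (n := fun ξ => (2 * Real.pi : ℂ) * a (2 * Real.pi * ξ))
    (contDiff_const.mul (ha.comp (contDiff_const.mul contDiff_id)))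
    (fun ξ => by rw [hΞ, hρ, fourierInv_conjS]; ring)
    (by simpa only [h3, ← mul_assoc] using hint')]
  have h4 := Measure.integral_comp_mul_left (fun ζ => a ζ * fourierHat c ζ) (2 * Real.pi)
  rw [abs_of_pos (inv_pos.2 hp), eq_inv_smul_iff₀ hp.ne'] at h4
  rw [← h4, ← integral_smul]
  congr 1; ext ξ
  rw [h3, Complex.real_smul]; push_cast; ring

/-! ### The admissibility constant as a Lebesgue integral -/

theorem integrable_mul_of_locallyIntegrableOn {g : ℝ → ℂ} {U : Set ℝ}
    (hg : LocallyIntegrableOn g U) {φ : ℝ → ℂ} (hφ : Continuous φ) (hφc : HasCompactSupport φ)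
    (hφU : tsupport φ ⊆ U) : Integrable fun ζ => φ ζ * g ζ := by
  have h1 : IntegrableOn g (tsupport φ) := hg.integrableOn_compact_subset hφU hφc
  have h2 : IntegrableOn (fun ζ => φ ζ * g ζ) (tsupport φ) :=
    h1.continuousOn_mul hφ.continuousOn hφc
  refine (integrableOn_iff_integrable_of_support_subset fun ζ hζ => ?_).1 h2
  exact subset_tsupport φ (left_ne_zero_of_mul hζ)

/-- On an open set where `η̂` is a locally integrable function `g`, the identity
`conj ψ̂ · g = ĉ` holds almost everywhere. -/
theorem ae_conj_mul_eq_fourierHat {ψ : 𝓢(ℝ, ℂ)} {η : 𝓢'(ℝ, ℂ)} {c : 𝓢(ℝ, ℂ)}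
    (hc : ∀ w, reflConv ψ η w = c w) {U : Set ℝ} (hU : IsOpen U) {g : ℝ → ℂ}
    (hg : LocallyIntegrableOn g U)
    (hgη : ∀ φ : 𝓢(ℝ, ℂ), HasCompactSupport φ → tsupport φ ⊆ U → distHat η φ = ∫ ζ, φ ζ * g ζ) :
    ∀ᵐ ζ, ζ ∈ U → conj (fourierHat ψ ζ) * g ζ = fourierHat c ζ := by
  have hψc : Continuous fun ζ => conj (fourierHat ψ ζ) :=
    Complex.continuous_conj.comp (fourierHat ψ).continuous
  have hψd : ContDiff ℝ ∞ fun ζ => conj (fourierHat ψ ζ) :=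
    Complex.conjCLE.contDiff.comp ((fourierHat ψ).smooth ⊤)
  have hloc : LocallyIntegrableOn (fun ζ => conj (fourierHat ψ ζ) * g ζ - fourierHat c ζ) U :=
    (hg.continuousOn_mul hψc.continuousOn hU.isLocallyClosed).sub
      ((fourierHat c).continuous.locallyIntegrable.locallyIntegrableOn U)
  have h := hU.ae_eq_zero_of_integral_contDiff_smul_eq_zero hloc fun φ hφ hφc hφU => by
    have hφd : ContDiff ℝ ∞ fun ζ => (φ ζ : ℂ) := Complex.ofRealCLM.contDiff.comp hφ
    have hφc' : HasCompactSupport fun ζ => (φ ζ : ℂ) :=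
      hφc.comp_left (g := ((↑) : ℝ → ℂ)) Complex.ofReal_zero
    have hs : HasCompactSupport fun ζ => (φ ζ : ℂ) * conj (fourierHat ψ ζ) := hφc'.mul_right
    let Φ : 𝓢(ℝ, ℂ) := hs.toSchwartzMap (hφd.mul hψd)
    have hΦ : ∀ ζ, Φ ζ = (φ ζ : ℂ) * conj (fourierHat ψ ζ) := fun ζ => rfl
    have hΦU : tsupport Φ ⊆ U := by
      refine (closure_mono fun ζ hζ => ?_).trans hφU
      have : (φ ζ : ℂ) ≠ 0 := left_ne_zero_of_mul (by simpa only [Function.mem_support, hΦ] using hζ)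
      simpa using this
    have hi1 : Integrable fun ζ => Φ ζ * g ζ :=
      integrable_mul_of_locallyIntegrableOn hg Φ.continuous hs hΦU
    have hi2 : Integrable fun ζ => (φ ζ : ℂ) * fourierHat c ζ :=
      (hφd.continuous.mul (fourierHat c).continuous).integrable_of_hasCompactSupport hφc'.mul_right
    have h1 := distHat_eq_integral hc hφd hΦ hi2
    rw [hgη Φ hs hΦU] at h1
    have h2 := integral_sub hi1 hi2
    rw [h1, sub_self] at h2
    rw [← h2]
    congr 1; ext ζ
    rw [hΦ, Complex.real_smul]; ring
  filter_upwards [h] with ζ hζ hζU using sub_eq_zero.1 (hζ hζU)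

/-- The constant `K_{ψ,η}` is the absolutely convergent integral of `ĉ(ζ) |ζ|^{-m}` when
`c = conj ψ̃ * η` is a Schwartz function; here in the normalisation `𝓕 c(ξ) = ĉ(2πξ)`, which
absorbs the factor `(2π)^(m-1)`. -/
theorem HasAdmissibilityConstant.integral_eq {m : ℕ} (hm : 1 ≤ m) {ψ : 𝓢(ℝ, ℂ)} {η : 𝓢'(ℝ, ℂ)}
    {K : ℂ} (hK : HasAdmissibilityConstant m ψ η K) {c : 𝓢(ℝ, ℂ)}
    (hc : ∀ w, reflConv ψ η w = c w) :
    Integrable (fun ξ : ℝ => 𝓕 c ξ / ((|ξ| ^ m : ℝ) : ℂ)) ∧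
      ∫ ξ : ℝ, 𝓕 c ξ / ((|ξ| ^ m : ℝ) : ℂ) = K := by
  obtain ⟨Ω, g, hΩ, hΩ0, hg, hgη, hgi, χ, ρ, hχ, hχc, hχΩ, hχ0, hρ, rfl⟩ := hK
  have hU : IsOpen (Ω \ {0}) := hΩ.sdiff isClosed_singleton
  have hae := ae_conj_mul_eq_fourierHat hc hU hg hgη
  let G : ℝ → ℂ := fun ζ => fourierHat c ζ / ((|ζ| ^ m : ℝ) : ℂ)
  have hGi : IntegrableOn G (Ω \ {0}) := by
    refine hgi.congr ?_
    filter_upwards [ae_restrict_of_ae hae, ae_restrict_mem hU.measurableSet] with ζ h1 h2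
    simp only [G, h1 h2]
  obtain ⟨M, hM⟩ := hχc.exists_bound_of_continuous hχ.continuous
  -- the part near `0`
  have hΩae : (Ω \ {0} : Set ℝ) =ᵐ[volume] Ω := sdiff_null_ae_eq_self (by simp)
  have hsupp : ∀ ζ ∉ Ω, (χ ζ : ℂ) * G ζ = 0 := fun ζ hζ => by
    rw [image_eq_zero_of_notMem_tsupport fun h => hζ (hχΩ h)]; simp
  have hn1 : Integrable fun ζ => (χ ζ : ℂ) * G ζ := by
    have h1 : IntegrableOn (fun ζ => (χ ζ : ℂ) * G ζ) (Ω \ {0}) :=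
      hGi.bdd_mul (c := M) (Complex.continuous_ofReal.comp hχ.continuous).aestronglyMeasurable
        (ae_of_all _ fun ζ => by rw [Complex.norm_real]; exact hM ζ)
    rw [integrableOn_congr_set_ae hΩae] at h1
    exact (integrableOn_iff_integrable_of_support_subset fun ζ hζ =>
      by_contra fun h => hζ (hsupp ζ h)).1 h1
  have hn2 : ∫ ζ in Ω \ {0}, (χ ζ : ℂ) * (conj (fourierHat ψ ζ) * g ζ / ((|ζ| ^ m : ℝ) : ℂ)) =
      ∫ ζ, (χ ζ : ℂ) * G ζ := by
    rw [← setIntegral_eq_integral_of_forall_compl_eq_zero (s := Ω) fun ζ hζ => hsupp ζ hζ,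
      ← setIntegral_congr_set hΩae]
    refine setIntegral_congr_ae hU.measurableSet ?_
    filter_upwards [hae] with ζ h1 h2
    simp only [G, h1 h2]
  -- the part away from `0`
  let a : ℝ → ℂ := fun ζ => (1 - (χ ζ : ℂ)) / ((|ζ| ^ m : ℝ) : ℂ)
  have ha : ContDiff ℝ ∞ a := by
    refine contDiff_iff_contDiffAt.2 fun ζ => ?_
    rcases eq_or_ne ζ 0 with rfl | hζ
    · refine (contDiffAt_const (c := (0 : ℂ))).congr_of_eventuallyEq ?_
      filter_upwards [hχ0] with ζ h
      simp [a, h]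
    · have hζm : ((|ζ| ^ m : ℝ) : ℂ) ≠ 0 := by
        exact_mod_cast (pow_pos (abs_pos.2 hζ) m).ne'
      have h1 : ContDiffAt ℝ ∞ (fun ζ : ℝ => ((|ζ| ^ m : ℝ) : ℂ)) ζ :=
        Complex.ofRealCLM.contDiff.contDiffAt.comp ζ ((contDiffAt_abs hζ).pow m)
      have h2 : ContDiffAt ℝ ∞ (fun ζ : ℝ => 1 - (χ ζ : ℂ)) ζ :=
        contDiffAt_const.sub (Complex.ofRealCLM.contDiff.comp hχ).contDiffAt
      simp only [a, div_eq_mul_inv]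
      exact h2.mul (h1.inv hζm)
  obtain ⟨r, hr0, hr⟩ := Metric.eventually_nhds_iff.1 hχ0
  have hab : ∀ ζ, ‖a ζ‖ ≤ (1 + M) / r ^ m := fun ζ => by
    have hM0 : 0 ≤ M := (norm_nonneg _).trans (hM 0)
    by_cases h : dist ζ 0 < r
    · simp only [a, hr h, Complex.ofReal_one, sub_self, zero_div, norm_zero]
      positivity
    · simp only [Real.dist_eq, sub_zero, not_lt] at h
      simp only [a]
      rw [norm_div, Complex.norm_real, Real.norm_of_nonneg (by positivity)]
      gcongr
      refine (norm_sub_le _ _).trans ?_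
      rw [norm_one, Complex.norm_real]
      linarith [hM ζ]
  have hf1 : Integrable fun ζ => a ζ * fourierHat c ζ :=
    (fourierHat c).integrable.bdd_mul (c := (1 + M) / r ^ m)
      ha.continuous.aestronglyMeasurable (ae_of_all _ hab)
  have hf2 : distHat η ρ = ∫ ζ, a ζ * fourierHat c ζ :=
    distHat_eq_integral hc ha (fun ζ => by rw [hρ]; simp only [a]; ring) hf1
  have hsum : ∀ ζ, (χ ζ : ℂ) * G ζ + a ζ * fourierHat c ζ = G ζ := fun ζ => by
    simp only [a, G]; ring
  have hG1 : Integrable G := (hn1.add hf1).congr (ae_of_all _ hsum)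
  have hG2 : ∫ ζ, G ζ = (∫ ζ, (χ ζ : ℂ) * G ζ) + ∫ ζ, a ζ * fourierHat c ζ := by
    rw [← integral_add hn1 hf1]
    simp only [hsum]
  -- change of variables `ζ = 2πξ`
  have hp : (0 : ℝ) < 2 * Real.pi := by positivity
  have hcv : ∀ ξ : ℝ, 𝓕 c ξ / ((|ξ| ^ m : ℝ) : ℂ) =
      ((2 * Real.pi) ^ m : ℝ) • G (2 * Real.pi * ξ) := fun ξ => by
    have h1 : fourierHat c (2 * Real.pi * ξ) = 𝓕 c ξ := by
      rw [fourierHat_eq, mul_right_comm, mul_inv_cancel₀ hp.ne', one_mul]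
    have h2 : (((2 * Real.pi) ^ m : ℝ) : ℂ) ≠ 0 := by exact_mod_cast (pow_pos hp m).ne'
    simp only [G]
    rw [h1, abs_mul, abs_of_pos hp, mul_pow (2 * Real.pi) |ξ| m, Complex.real_smul,
      Complex.ofReal_mul ((2 * Real.pi) ^ m), ← mul_div_assoc, mul_div_mul_left _ _ h2]
  refine ⟨?_, ?_⟩
  · simp only [hcv]
    exact (hG1.comp_mul_left' hp.ne').fun_smul _
  · simp only [hcv]
    rw [integral_smul, Measure.integral_comp_mul_left, hn2, hf2, ← hG2, smul_smul,
      abs_of_pos (inv_pos.2 hp), Complex.real_smul]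
    congr 1
    obtain ⟨k, rfl⟩ : ∃ k, m = k + 1 := ⟨m - 1, by omega⟩
    rw [pow_succ, mul_assoc, mul_inv_cancel₀ hp.ne', mul_one, Nat.add_sub_cancel]
    push_cast; rfl

/-! ### Fourier transforms of integrable functions -/

section Fourier

variable {V : Type*} [NormedAddCommGroup V] [InnerProductSpace ℝ V] [FiniteDimensional ℝ V]
  [MeasurableSpace V] [BorelSpace V]

theorem continuous_fourier_of_integrable {f : V → ℂ} (hf : Integrable f) : Continuous (𝓕 f) :=
  VectorFourier.fourierIntegral_continuous Real.continuous_fourierChar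
    (by exact continuous_inner) hf

theorem norm_fourier_le_integral_norm (f : V → ℂ) (ξ : V) : ‖𝓕 f ξ‖ ≤ ∫ x, ‖f x‖ :=
  VectorFourier.norm_fourierIntegral_le_integral_norm _ _ _ f ξ

theorem integral_fourier_mul_eq_of_integrable {f g : V → ℂ} (hf : Integrable f)
    (hg : Integrable g) : ∫ ξ, 𝓕 f ξ * g ξ = ∫ x, f x * 𝓕 g x := by
  have h := VectorFourier.integral_fourierIntegral_smul_eq_flip (L := innerₗ V)
    Real.continuous_fourierChar continuous_inner hf hg
  rwa [flip_innerₗ] at h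

end Fourier

/-! ### The Radon transform of an integrable function -/

variable {m : ℕ}

/-- The measurable equivalence `(p, y) ↦ p u + y` from `ℝ × (ℝ u)ᗮ` to `ℝ^m`. -/
def hyperplaneEquiv (u : Sph m) :
    ℝ × (Submodule.span ℝ {(u : EuclideanSpace ℝ (Fin m))})ᗮ ≃ᵐ EuclideanSpace ℝ (Fin m) :=
  (((LinearIsometryEquiv.toSpanUnitSingleton (u : EuclideanSpace ℝ (Fin m))
    (norm_eq_of_mem_sphere u)).toMeasurableEquiv.prodCongr (MeasurableEquiv.refl _)).trans
    (MeasurableEquiv.toLp 2 _)).trans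
    (Submodule.orthogonalDecomposition (𝕜 := ℝ) _).symm.toMeasurableEquiv

theorem hyperplaneEquiv_apply (u : Sph m)
    (q : ℝ × (Submodule.span ℝ {(u : EuclideanSpace ℝ (Fin m))})ᗮ) :
    hyperplaneEquiv u q = q.1 • (u : EuclideanSpace ℝ (Fin m)) + q.2 := by
  change (Submodule.orthogonalDecomposition (𝕜 := ℝ) _).symm _ = _
  rw [Submodule.orthogonalDecomposition_symm_apply]
  rfl

theorem measurePreserving_hyperplaneEquiv (u : Sph m) :
    MeasurePreserving (hyperplaneEquiv u) := by
  have h1 : MeasurePreserving ((LinearIsometryEquiv.toSpanUnitSingleton (𝕜 := ℝ)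
      (u : EuclideanSpace ℝ (Fin m)) (norm_eq_of_mem_sphere u)).toMeasurableEquiv.prodCongr
      (MeasurableEquiv.refl (Submodule.span ℝ {(u : EuclideanSpace ℝ (Fin m))})ᗮ))
      volume volume :=
    (LinearIsometryEquiv.measurePreserving (LinearIsometryEquiv.toSpanUnitSingleton (𝕜 := ℝ)
      (u : EuclideanSpace ℝ (Fin m)) (norm_eq_of_mem_sphere u))).prod (MeasurePreserving.id volume)
  exact (h1.trans (WithLp.volume_preserving_toLp _ _)).trans
    (LinearIsometryEquiv.measurePreserving _)

theorem inner_hyperplaneEquiv (u : Sph m)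
    (q : ℝ × (Submodule.span ℝ {(u : EuclideanSpace ℝ (Fin m))})ᗮ) :
    ⟪hyperplaneEquiv u q, (u : EuclideanSpace ℝ (Fin m))⟫ = q.1 := by
  have h1 : ⟪(q.2 : EuclideanSpace ℝ (Fin m)), (u : EuclideanSpace ℝ (Fin m))⟫ = 0 := by
    rw [real_inner_comm]
    exact Submodule.mem_orthogonal_singleton_iff_inner_right.1 q.2.2
  rw [hyperplaneEquiv_apply, inner_add_left, h1, real_inner_smul_left, real_inner_self_eq_norm_sq,
    norm_eq_of_mem_sphere u]
  norm_num

theorem radon_eq (f : EuclideanSpace ℝ (Fin m) → ℂ) (u : Sph m) (p : ℝ) :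
    radon f u p = ∫ y, f (hyperplaneEquiv u (p, y)) := by
  simp only [hyperplaneEquiv_apply]; rfl

theorem integrable_comp_hyperplaneEquiv {f : EuclideanSpace ℝ (Fin m) → ℂ} (hf : Integrable f)
    (u : Sph m) : Integrable (fun q => f (hyperplaneEquiv u q)) (volume.prod volume) :=
  ((measurePreserving_hyperplaneEquiv u).integrable_comp_emb
    (hyperplaneEquiv u).measurableEmbedding).2 hf

theorem integrable_radon {f : EuclideanSpace ℝ (Fin m) → ℂ} (hf : Integrable f) (u : Sph m) :
    Integrable (radon f u) := by
  simp only [funext (radon_eq f u)]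
  exact (integrable_comp_hyperplaneEquiv hf u).integral_prod_left

theorem integral_radon_mul {f : EuclideanSpace ℝ (Fin m) → ℂ} (hf : Integrable f) (u : Sph m)
    {h : ℝ → ℂ} (hh : Continuous h) {B : ℝ} (hB : ∀ p, ‖h p‖ ≤ B) :
    ∫ p, radon f u p * h p = ∫ x, f x * h ⟪x, (u : EuclideanSpace ℝ (Fin m))⟫ := by
  have h1 : Integrable fun x => f x * h ⟪x, (u : EuclideanSpace ℝ (Fin m))⟫ :=
    hf.mul_bdd (c := B) (by fun_prop) (ae_of_all _ fun _ => hB _)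
  rw [← (measurePreserving_hyperplaneEquiv u).integral_comp'
    fun x => f x * h ⟪x, (u : EuclideanSpace ℝ (Fin m))⟫]
  rw [show (volume : Measure (ℝ × (Submodule.span ℝ {(u : EuclideanSpace ℝ (Fin m))})ᗮ)) =
    volume.prod volume from rfl, integral_prod _ (integrable_comp_hyperplaneEquiv h1 u)]
  simp only [inner_hyperplaneEquiv, integral_mul_const, ← radon_eq]

/-- The Fourier slice theorem. -/
theorem fourier_radon {f : EuclideanSpace ℝ (Fin m) → ℂ} (hf : Integrable f) (u : Sph m) (s : ℝ) :
    𝓕 (radon f u) s = 𝓕 f (s • (u : EuclideanSpace ℝ (Fin m))) := by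
  have h := integral_radon_mul hf u
    (h := fun p => Complex.exp (((-2 * Real.pi * p * s : ℝ) : ℂ) * Complex.I)) (by fun_prop)
    (B := 1) fun p => (Complex.norm_exp_ofReal_mul_I _).le
  rw [fourier_real_apply, Real.fourier_eq']
  simp only [mul_comm (Complex.exp _), smul_eq_mul]
  rw [h]
  congr 1; ext x
  rw [real_inner_smul_right, mul_assoc _ _ s, mul_comm s]

/-- The pairing of the Radon transform with a dilated translate, on the Fourier side. -/
theorem integral_radon_mul_fourier {f : EuclideanSpace ℝ (Fin m) → ℂ} (hf : Integrable f)
    (u : Sph m) (κ : 𝓢(ℝ, ℂ)) {α : ℝ} (hα : 0 < α) (β : ℝ) :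
    ∫ p, radon f u p * (𝓕 κ ((p - β) / α) / (α : ℂ)) =
      ∫ s : ℝ, 𝓕 f (s • (u : EuclideanSpace ℝ (Fin m))) *
        (κ (α * s) * Complex.exp (((2 * Real.pi * s * β : ℝ) : ℂ) * Complex.I)) := by
  have hκ : Integrable fun s : ℝ =>
      κ (α * s) * Complex.exp (((2 * Real.pi * s * β : ℝ) : ℂ) * Complex.I) :=
    (κ.integrable.comp_mul_left' hα.ne').mul_bdd (c := 1) (by fun_prop)
      (ae_of_all _ fun _ => (Complex.norm_exp_ofReal_mul_I _).le)
  simp only [← fourier_radon hf]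
  rw [integral_fourier_mul_eq_of_integrable (integrable_radon hf u) hκ]
  congr 1; ext p
  congr 1
  rw [fourier_real_apply, SchwartzMap.fourier_coe, fourier_real_apply]
  have h := Measure.integral_comp_mul_left (fun v : ℝ =>
    Complex.exp (((-2 * Real.pi * v * ((p - β) / α) : ℝ) : ℂ) * Complex.I) * κ v) α
  rw [abs_of_pos (inv_pos.2 hα), Complex.real_smul, Complex.ofReal_inv] at h
  rw [div_eq_inv_mul, ← h]
  congr 1; ext s
  have h2 : -2 * Real.pi * (α * s) * ((p - β) / α) = -2 * Real.pi * s * p + 2 * Real.pi * s * β := by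
    field_simp; ring
  rw [h2, Complex.ofReal_add, add_mul, Complex.exp_add]
  ring

/-! ### The inner integrals of the dual ridgelet transform -/

theorem reflConv_eq_fourier_fourier {ψ : 𝓢(ℝ, ℂ)} {η : 𝓢'(ℝ, ℂ)} {c : 𝓢(ℝ, ℂ)}
    (hc : ∀ w, reflConv ψ η w = c w) (w : ℝ) : reflConv ψ η w = 𝓕 (𝓕 c) (-w) := by
  have h : c w = 𝓕⁻ (𝓕 c) w := by simp
  rw [hc, h, SchwartzMap.fourierInv_coe, Real.fourierInv_eq_fourier_neg,
    SchwartzMap.fourier_coe (𝓕 c)]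

/-- The bracket in the definition of the truncated operator, on the Fourier side. -/
theorem innerConv_eq {ψ : 𝓢(ℝ, ℂ)} {η : 𝓢'(ℝ, ℂ)} {c : 𝓢(ℝ, ℂ)}
    (hc : ∀ w, reflConv ψ η w = c w) {f : EuclideanSpace ℝ (Fin m) → ℂ} (hf : Integrable f)
    (u : Sph m) {α : ℝ} (hα : 0 < α) (β : ℝ) :
    innerConv ψ η f u α β = ∫ s : ℝ, 𝓕 f (s • (u : EuclideanSpace ℝ (Fin m))) *
        (𝓕 c (α * s) * Complex.exp (((2 * Real.pi * s * β : ℝ) : ℂ) * Complex.I)) := by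
  rw [← integral_radon_mul_fourier hf u (𝓕 c) hα β, innerConv]
  simp only [reflConv_eq_fourier_fourier hc, ← neg_div, neg_sub]

/-- The ridgelet transform on the Fourier side. -/
theorem ridgelet_eq (ψ : 𝓢(ℝ, ℂ)) {f : EuclideanSpace ℝ (Fin m) → ℂ} (hf : Integrable f)
    (u : Sph m) {α : ℝ} (hα : 0 < α) (β : ℝ) :
    ridgelet ψ f u α β = ∫ s : ℝ, 𝓕 f (s • (u : EuclideanSpace ℝ (Fin m))) *
        (𝓕⁻ (conjS ψ) (α * s) * Complex.exp (((2 * Real.pi * s * β : ℝ) : ℂ) * Complex.I)) := by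
  rw [← integral_radon_mul_fourier hf u _ hα β, ridgelet, FourierTransform.fourier_fourierInv_eq]
  have h := Measure.integral_comp_mul_left
    (fun p => radon f u (p + β) * conjS ψ (p / α)) α
  rw [abs_of_pos (inv_pos.2 hα)] at h
  have h1 : ∀ z, conj (ψ z) = conjS ψ (α * z / α) := fun z => by
    rw [mul_div_cancel_left₀ _ hα.ne']; rfl
  simp only [h1]
  rw [h, ← integral_sub_right_eq_self _ β, ← integral_smul]
  congr 1; ext p
  rw [sub_add_cancel, Complex.real_smul, Complex.ofReal_inv]
  ring

/-- The smooth function whose product with `𝓕⁻¹ (conj ψ)` has Fourier transform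
`z ↦ R_ψ f(u, α, β - α z)`. -/
def ridgeletSymbol (f : 𝓢(EuclideanSpace ℝ (Fin m), ℂ)) (u : Sph m) (α β : ℝ) (s : ℝ) : ℂ :=
  (α : ℂ)⁻¹ * (Complex.exp (((2 * Real.pi * (s / α) * β : ℝ) : ℂ) * Complex.I) *
    𝓕 f ((s / α) • (u : EuclideanSpace ℝ (Fin m))))

theorem hasTemperateGrowth_cexp_mul_I (a : ℝ) :
    Function.HasTemperateGrowth fun s : ℝ => Complex.exp (((a * s : ℝ) : ℂ) * Complex.I) := by
  have hd : ∀ n : ℕ, iteratedDeriv n (fun s : ℝ => Complex.exp (((a * s : ℝ) : ℂ) * Complex.I)) =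
      fun s => (a * Complex.I) ^ n * Complex.exp (((a * s : ℝ) : ℂ) * Complex.I) := by
    intro n
    induction n with
    | zero => simp
    | succ n ih =>
      rw [iteratedDeriv_succ, ih]
      ext s
      have h1 : HasDerivAt (fun s : ℝ => (((a * s : ℝ) : ℂ) * Complex.I)) (a * Complex.I) s := by
        simpa using (((hasDerivAt_id s).const_mul a).ofReal_comp).mul_const Complex.I
      rw [(h1.cexp.const_mul _).deriv]
      ring
  refine ⟨?_, fun n => ⟨0, |a| ^ n, fun s => ?_⟩⟩
  · have h : ContDiff ℝ ∞ fun s : ℝ => a * s := by fun_prop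
    exact Complex.contDiff_exp.comp ((Complex.ofRealCLM.contDiff.comp h).mul contDiff_const)
  · rw [norm_iteratedFDeriv_eq_norm_iteratedDeriv, hd, norm_mul, Complex.norm_exp_ofReal_mul_I]
    simp

theorem hasTemperateGrowth_ridgeletSymbol (f : 𝓢(EuclideanSpace ℝ (Fin m), ℂ)) (u : Sph m)
    (α β : ℝ) : (ridgeletSymbol f u α β).HasTemperateGrowth := by
  refine (Function.HasTemperateGrowth.const _).mul (Function.HasTemperateGrowth.mul ?_ ?_)
  · have h := hasTemperateGrowth_cexp_mul_I (2 * Real.pi / α * β)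
    simpa only [show ∀ s : ℝ, 2 * Real.pi / α * β * s = 2 * Real.pi * (s / α) * β from
      fun s => by ring] using h
  · refine (𝓕 f).hasTemperateGrowth.comp (f := fun s : ℝ => (s / α) • (u : EuclideanSpace ℝ (Fin m))) ?_
    simp only [div_eq_mul_inv]
    fun_prop

/-- The Schwartz function `𝓕⁻¹ (conj ψ)` multiplied by `ridgeletSymbol`. -/
def ridgeletHat (ψ : 𝓢(ℝ, ℂ)) (f : 𝓢(EuclideanSpace ℝ (Fin m), ℂ)) (u : Sph m) (α β : ℝ) :
    𝓢(ℝ, ℂ) :=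
  SchwartzMap.smulLeftCLM ℂ (ridgeletSymbol f u α β) (𝓕⁻ (conjS ψ))

theorem ridgeletHat_apply (ψ : 𝓢(ℝ, ℂ)) (f : 𝓢(EuclideanSpace ℝ (Fin m), ℂ)) (u : Sph m)
    (α β s : ℝ) :
    ridgeletHat ψ f u α β s = ridgeletSymbol f u α β s * 𝓕⁻ (conjS ψ) s :=
  SchwartzMap.smulLeftCLM_apply_apply (hasTemperateGrowth_ridgeletSymbol f u α β) _ _

/-- The function `z ↦ R_ψ f(u, α, β - α z)` is a Schwartz function, being the Fourier transform of
one. -/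
theorem fourier_ridgeletHat (ψ : 𝓢(ℝ, ℂ)) (f : 𝓢(EuclideanSpace ℝ (Fin m), ℂ)) (u : Sph m)
    {α : ℝ} (hα : 0 < α) (β z : ℝ) :
    𝓕 (ridgeletHat ψ f u α β) z = ridgelet ψ f u α (β - α * z) := by
  rw [ridgelet_eq ψ f.integrable u hα, SchwartzMap.fourier_coe, fourier_real_apply]
  have h := Measure.integral_comp_mul_left (fun v : ℝ =>
    Complex.exp (((-2 * Real.pi * v * z : ℝ) : ℂ) * Complex.I) * ridgeletHat ψ f u α β v) α
  have hα' : (α : ℂ) ≠ 0 := by exact_mod_cast hα.ne'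
  rw [abs_of_pos (inv_pos.2 hα), Complex.real_smul, Complex.ofReal_inv, eq_inv_mul_iff_mul_eq₀ hα',
    ← integral_const_mul] at h
  rw [← h]
  congr 1; ext s
  rw [ridgeletHat_apply, ridgeletSymbol, mul_div_cancel_left₀ _ hα.ne', SchwartzMap.fourier_coe,
    show 2 * Real.pi * s * (β - α * z) = -2 * Real.pi * (α * s) * z + 2 * Real.pi * s * β by ring,
    Complex.ofReal_add, add_mul, Complex.exp_add]
  field_simp

/-- On Schwartz functions the action of `η` is given by the convolution form. -/
theorem dualInner_ridgelet_eq_innerConv {ψ : 𝓢(ℝ, ℂ)} {η : 𝓢'(ℝ, ℂ)} {c : 𝓢(ℝ, ℂ)}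
    (hc : ∀ w, reflConv ψ η w = c w) (f : 𝓢(EuclideanSpace ℝ (Fin m), ℂ)) (u : Sph m)
    {α : ℝ} (hα : 0 < α) (β : ℝ) :
    dualInner η (ridgelet ψ f) u α β = innerConv ψ η f u α β := by
  have hs := hasTemperateGrowth_ridgeletSymbol f u α β
  have hint : Integrable fun s => ridgeletSymbol f u α β s * 𝓕 c s := by
    refine (SchwartzMap.smulLeftCLM ℂ (ridgeletSymbol f u α β) (𝓕 c)).integrable.congr
      (ae_of_all _ fun s => ?_)
    exact SchwartzMap.smulLeftCLM_apply_apply hs _ _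
  rw [innerConv_eq hc f.integrable u hα, dualInner,
    ← funext (fourier_ridgeletHat ψ f u hα β), distAction_coe,
    dist_fourier_eq_integral hc hs.1 (ridgeletHat_apply ψ f u α β) hint]
  have h := Measure.integral_comp_mul_left (fun s : ℝ => ridgeletSymbol f u α β s * 𝓕 c s) α
  have hα' : (α : ℂ) ≠ 0 := by exact_mod_cast hα.ne'
  rw [abs_of_pos (inv_pos.2 hα), Complex.real_smul, Complex.ofReal_inv, eq_inv_mul_iff_mul_eq₀ hα',
    ← integral_const_mul] at h
  rw [← h]
  congr 1; ext s
  rw [ridgeletSymbol, mul_div_cancel_left₀ _ hα.ne', SchwartzMap.fourier_coe f]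
  field_simp

/-! ### Polar coordinates -/

instance : IsFiniteMeasure (surf m) := by
  unfold surf; infer_instance

/-- The measure `r^(m-1) dr` on the half-line `r > 0`, as a measure on the line. -/
def radialMeasure (m : ℕ) : Measure ℝ :=
  (volume.restrict (Ioi 0)).withDensity fun r => ENNReal.ofReal (r ^ (m - 1))

theorem measurePreserving_val_volumeIoiPow :
    MeasurePreserving Subtype.val (Measure.volumeIoiPow (m - 1)) (radialMeasure m) := by
  refine ⟨measurable_subtype_coe, ?_⟩
  ext s hs
  have h1 : Measurable fun r : ℝ => ENNReal.ofReal (r ^ (m - 1)) := by fun_prop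
  rw [Measure.map_apply measurable_subtype_coe hs, radialMeasure, withDensity_apply _ hs,
    Measure.volumeIoiPow, withDensity_apply _ (measurable_subtype_coe hs),
    setLIntegral_subtype measurableSet_Ioi _ fun r : ℝ => ENNReal.ofReal (r ^ (m - 1)),
    Measure.restrict_restrict hs, Subtype.image_preimage_coe, inter_comm]

instance : SFinite (radialMeasure m) := by
  unfold radialMeasure; infer_instance

/-- Polar coordinates, with the radius in `ℝ` and the radial measure carried by `r > 0`. -/
theorem measurePreserving_polar (hm : 1 ≤ m) :
    MeasurePreserving (fun q : Sph m × ℝ => q.2 • (q.1 : EuclideanSpace ℝ (Fin m)))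
      ((surf m).prod (radialMeasure m)) volume := by
  have hnt : Nonempty (Fin m) := ⟨⟨0, hm⟩⟩
  have h1 := (volume : Measure (EuclideanSpace ℝ (Fin m))).measurePreserving_homeomorphUnitSphereProd
  rw [finrank_euclideanSpace_fin] at h1
  have h2 := MeasurePreserving.symm
    (homeomorphUnitSphereProd (EuclideanSpace ℝ (Fin m))).toMeasurableEquiv h1
  have h3 : MeasurePreserving (Subtype.val : ({0}ᶜ : Set (EuclideanSpace ℝ (Fin m))) → _)
      (volume.comap Subtype.val) volume := by
    refine ⟨measurable_subtype_coe, ?_⟩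
    rw [map_comap_subtype_coe (measurableSet_singleton _).compl, restrict_compl_singleton]
  have h4 := h3.comp h2
  have h5 : MeasurePreserving (Prod.map id Subtype.val : Sph m × Ioi (0 : ℝ) → Sph m × ℝ)
      ((surf m).prod (Measure.volumeIoiPow (m - 1))) ((surf m).prod (radialMeasure m)) :=
    (MeasurePreserving.id _).prod measurePreserving_val_volumeIoiPow
  have hmeas : Measurable fun q : Sph m × ℝ => q.2 • (q.1 : EuclideanSpace ℝ (Fin m)) := by
    fun_prop
  refine ⟨hmeas, ?_⟩
  rw [← h5.map_eq, Measure.map_map hmeas h5.measurable]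
  exact h4.map_eq

theorem prod_radialMeasure :
    (surf m).prod (radialMeasure m) = ((surf m).prod (volume.restrict (Ioi 0))).withDensity
      fun q => ENNReal.ofReal (q.2 ^ (m - 1)) :=
  prod_withDensity_right (by fun_prop)

theorem ae_prod_restrict {P : ℝ → Prop} {s : Set ℝ} (hs : MeasurableSet s)
    (h : ∀ r ∈ s, P r) : ∀ᵐ q ∂((surf m).prod (volume.restrict s)), P q.2 :=
  Measure.quasiMeasurePreserving_snd.ae (p := P) (ae_restrict_of_forall_mem hs h)

theorem integrable_of_polar (hm : 1 ≤ m) {F : EuclideanSpace ℝ (Fin m) → ℂ}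
    (hF : Measurable F) (h : Integrable (fun q : Sph m × ℝ =>
      (q.2 ^ (m - 1)) • F (q.2 • (q.1 : EuclideanSpace ℝ (Fin m))))
      ((surf m).prod (volume.restrict (Ioi 0)))) : Integrable F := by
  rw [← (measurePreserving_polar hm).map_eq,
    integrable_map_measure hF.aestronglyMeasurable (measurePreserving_polar hm).aemeasurable,
    prod_radialMeasure, integrable_withDensity_iff_integrable_smul' (by fun_prop)
    (ae_of_all _ fun _ => ENNReal.ofReal_lt_top)]
  refine h.congr ?_
  filter_upwards [ae_prod_restrict (m := m) (P := fun r => 0 < r) measurableSet_Ioi fun r hr => hr]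
    with q hq
  rw [ENNReal.toReal_ofReal (pow_nonneg hq.le _)]
  rfl

theorem integral_polar (hm : 1 ≤ m) {F : EuclideanSpace ℝ (Fin m) → ℂ}
    (hF : Measurable F) (h : Integrable (fun q : Sph m × ℝ =>
      (q.2 ^ (m - 1)) • F (q.2 • (q.1 : EuclideanSpace ℝ (Fin m))))
      ((surf m).prod (volume.restrict (Ioi 0)))) :
    ∫ x, F x = ∫ u : Sph m, (∫ r in Ioi (0 : ℝ),
      (r ^ (m - 1)) • F (r • (u : EuclideanSpace ℝ (Fin m)))) ∂(surf m) := by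
  rw [← integral_prod _ h, ← (measurePreserving_polar hm).map_eq,
    integral_map (measurePreserving_polar hm).aemeasurable hF.aestronglyMeasurable,
    prod_radialMeasure, integral_withDensity_eq_integral_toReal_smul (by fun_prop)
    (ae_of_all _ fun _ => ENNReal.ofReal_lt_top)]
  refine integral_congr_ae ?_
  filter_upwards [ae_prod_restrict (m := m) (P := fun r => 0 < r) measurableSet_Ioi fun r hr => hr]
    with q hq
  rw [ENNReal.toReal_ofReal (pow_nonneg hq.le _)]

/-! ### The truncated operator as a Fourier multiplier -/

/-- The average `∫_ε^δ C(α s) α^{-m} dα` of the dilates of `C`. -/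
def dilationAverage (m : ℕ) (C : 𝓢(ℝ, ℂ)) (ε δ s : ℝ) : ℂ :=
  ∫ α in Ioo ε δ, C (α * s) / ((α ^ m : ℝ) : ℂ)

/-- The Fourier multiplier of the truncated reconstruction operator, for `C = 𝓕 c`. The value at
`ξ = 0`, where the denominator may vanish, is irrelevant. -/
def multiplier (m : ℕ) (C : 𝓢(ℝ, ℂ)) (ε δ : ℝ) (ξ : EuclideanSpace ℝ (Fin m)) : ℂ :=
  (dilationAverage m C ε δ ‖ξ‖ + dilationAverage m C ε δ (-‖ξ‖)) / ((‖ξ‖ ^ (m - 1) : ℝ) : ℂ)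

theorem integral_norm_dilate (C : 𝓢(ℝ, ℂ)) {α : ℝ} (hα : 0 < α) :
    ∫ s, ‖C (α * s)‖ = α⁻¹ * ∫ s, ‖C s‖ := by
  have h := Measure.integral_comp_mul_left (fun s => ‖C s‖) α
  rwa [abs_of_pos (inv_pos.2 hα), smul_eq_mul] at h

theorem norm_div_pow_le {z : ℂ} {α ε : ℝ} (hε : 0 < ε) (hα : ε ≤ α) :
    ‖z / ((α ^ m : ℝ) : ℂ)‖ ≤ (ε ^ m)⁻¹ * ‖z‖ := by
  rw [norm_div, Complex.norm_real, Real.norm_of_nonneg (pow_nonneg (hε.le.trans hα) m),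
    div_eq_inv_mul]
  gcongr

theorem integrable_dilate (C : 𝓢(ℝ, ℂ)) {ε : ℝ} (hε : 0 < ε) (δ : ℝ) {g : ℝ → ℂ}
    (hg : Measurable g) {B : ℝ} (hB : ∀ s, ‖g s‖ ≤ B) :
    Integrable (fun q : ℝ × ℝ => g q.2 * (C (q.1 * q.2) / ((q.1 ^ m : ℝ) : ℂ)))
      ((volume.restrict (Ioo ε δ)).prod volume) := by
  have hm : Measurable fun q : ℝ × ℝ => C (q.1 * q.2) / ((q.1 ^ m : ℝ) : ℂ) := by
    have := C.continuous.measurable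
    fun_prop
  have h1 : Integrable (fun q : ℝ × ℝ => C (q.1 * q.2) / ((q.1 ^ m : ℝ) : ℂ))
      ((volume.restrict (Ioo ε δ)).prod volume) := by
    refine (integrable_prod_iff hm.aestronglyMeasurable).2 ⟨?_, ?_⟩
    · refine ae_restrict_of_forall_mem measurableSet_Ioo fun α hα => ?_
      have h := (C.integrable.comp_mul_left' (hε.trans hα.1).ne').div_const ((α ^ m : ℝ) : ℂ)
      exact h
    · refine Integrable.of_bound hm.norm.stronglyMeasurable.integral_prod_right'.aestronglyMeasurable
        ((ε ^ m)⁻¹ * (ε⁻¹ * ∫ s, ‖C s‖)) (ae_restrict_of_forall_mem measurableSet_Ioo fun α hα => ?_)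
      rw [Real.norm_of_nonneg (integral_nonneg fun _ => norm_nonneg _)]
      calc ∫ s, ‖C (α * s) / ((α ^ m : ℝ) : ℂ)‖
          ≤ ∫ s, (ε ^ m)⁻¹ * ‖C (α * s)‖ := by
            refine integral_mono_of_nonneg (ae_of_all _ fun _ => norm_nonneg _)
              ((C.integrable.comp_mul_left' (hε.trans hα.1).ne').norm.const_mul _)
              (ae_of_all _ fun s => norm_div_pow_le hε hα.1.le)
        _ = (ε ^ m)⁻¹ * (α⁻¹ * ∫ s, ‖C s‖) := by
            rw [integral_const_mul, integral_norm_dilate C (hε.trans hα.1)]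
        _ ≤ _ := by
            have h0 : 0 ≤ ∫ s, ‖C s‖ := integral_nonneg fun _ => norm_nonneg _
            have := hα.1.le
            gcongr
  exact h1.bdd_mul (c := B) (hg.comp measurable_snd).aestronglyMeasurable (ae_of_all _ fun q => hB _)

theorem measurable_dilationAverage (m : ℕ) (C : 𝓢(ℝ, ℂ)) (ε δ : ℝ) :
    Measurable (dilationAverage m C ε δ) := by
  have hm : Measurable fun q : ℝ × ℝ => C (q.2 * q.1) / ((q.2 ^ m : ℝ) : ℂ) := by
    have := C.continuous.measurable
    fun_prop
  exact hm.stronglyMeasurable.integral_prod_right'.measurable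

theorem integrable_dilationAverage (C : 𝓢(ℝ, ℂ)) {ε : ℝ} (hε : 0 < ε) (δ : ℝ) :
    Integrable (dilationAverage m C ε δ) := by
  have h := (integrable_dilate (m := m) C hε δ (g := fun _ => 1) measurable_const
    (B := 1) (by simp)).integral_prod_right
  simp only [one_mul] at h
  exact h

theorem measurable_multiplier (m : ℕ) (C : 𝓢(ℝ, ℂ)) (ε δ : ℝ) :
    Measurable (multiplier m C ε δ) := by
  have := measurable_dilationAverage m C ε δ
  unfold multiplier
  fun_prop

/-- The integral over the sphere and the line of a function on `ℝ^m` against a density on the line,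
in polar coordinates. -/
theorem integral_sphere_line (hm : 1 ≤ m) {N : ℝ → ℂ} (hNm : Measurable N) (hN : Integrable N)
    {G : EuclideanSpace ℝ (Fin m) → ℂ} (hG : Continuous G) {B : ℝ} (hB : ∀ ξ, ‖G ξ‖ ≤ B) :
    Integrable (fun ξ => G ξ * ((N ‖ξ‖ + N (-‖ξ‖)) / ((‖ξ‖ ^ (m - 1) : ℝ) : ℂ))) ∧
    ∫ u : Sph m, (∫ s, G (s • (u : EuclideanSpace ℝ (Fin m))) * N s) ∂(surf m) =
      ∫ ξ, G ξ * ((N ‖ξ‖ + N (-‖ξ‖)) / ((‖ξ‖ ^ (m - 1) : ℝ) : ℂ)) := by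
  -- The formula on the half-line; the line is the union of the half-line and its reflection.
  have hline : ∀ (H : EuclideanSpace ℝ (Fin m) → ℂ) (P : ℝ → ℂ), Continuous H →
      (∀ ξ, ‖H ξ‖ ≤ B) → Measurable P → Integrable P →
      Integrable (fun ξ => H ξ * (P ‖ξ‖ / ((‖ξ‖ ^ (m - 1) : ℝ) : ℂ))) ∧
      Integrable (fun u : Sph m => ∫ r in Ioi (0 : ℝ),
        H (r • (u : EuclideanSpace ℝ (Fin m))) * P r) (surf m) ∧
      ∫ ξ, H ξ * (P ‖ξ‖ / ((‖ξ‖ ^ (m - 1) : ℝ) : ℂ)) =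
        ∫ u : Sph m, (∫ r in Ioi (0 : ℝ),
          H (r • (u : EuclideanSpace ℝ (Fin m))) * P r) ∂(surf m) := by
    intro H P hH hHB hPm hP
    have hF : Measurable fun ξ : EuclideanSpace ℝ (Fin m) =>
        H ξ * (P ‖ξ‖ / ((‖ξ‖ ^ (m - 1) : ℝ) : ℂ)) := by
      have := hH.measurable
      fun_prop
    have heq : ∀ (u : Sph m) (r : ℝ), 0 < r → (r ^ (m - 1)) •
        (H (r • (u : EuclideanSpace ℝ (Fin m))) * (P ‖r • (u : EuclideanSpace ℝ (Fin m))‖ /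
          ((‖r • (u : EuclideanSpace ℝ (Fin m))‖ ^ (m - 1) : ℝ) : ℂ))) =
        H (r • (u : EuclideanSpace ℝ (Fin m))) * P r := fun u r hr => by
      have h0 : ((r ^ (m - 1) : ℝ) : ℂ) ≠ 0 := by exact_mod_cast (pow_pos hr _).ne'
      rw [norm_smul, norm_eq_of_mem_sphere, mul_one, Real.norm_of_nonneg hr.le, Complex.real_smul]
      field_simp
    have hi : Integrable (fun q : Sph m × ℝ => H (q.2 • (q.1 : EuclideanSpace ℝ (Fin m))) * P q.2)
        ((surf m).prod (volume.restrict (Ioi 0))) := by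
      have h1 : Integrable (fun q : Sph m × ℝ => P q.2)
          ((surf m).prod (volume.restrict (Ioi 0))) := hP.restrict.comp_snd _
      refine h1.bdd_mul (c := B) ?_ (ae_of_all _ fun q => hHB _)
      exact (hH.comp (by fun_prop)).aestronglyMeasurable
    have hi' := hi.congr ((ae_prod_restrict (m := m) (P := fun r => 0 < r) measurableSet_Ioi
      fun r hr => hr).mono fun q hq => (heq q.1 q.2 hq).symm)
    refine ⟨integrable_of_polar hm hF hi', hi.integral_prod_left, ?_⟩
    rw [integral_polar hm hF hi']
    congr 1; ext u
    exact setIntegral_congr_fun measurableSet_Ioi fun r hr => heq u r hr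
  obtain ⟨h1, h2, h3⟩ := hline G N hG hB hNm hN
  obtain ⟨h4, h5, h6⟩ := hline (fun ξ => G (-ξ)) (fun s => N (-s)) (by fun_prop) (fun ξ => hB _)
    (by fun_prop) hN.comp_neg
  have h4' : Integrable fun ξ : EuclideanSpace ℝ (Fin m) =>
      G ξ * (N (-‖ξ‖) / ((‖ξ‖ ^ (m - 1) : ℝ) : ℂ)) := by
    simpa only [neg_neg, norm_neg] using h4.comp_neg
  have h6' : ∫ ξ, G ξ * (N (-‖ξ‖) / ((‖ξ‖ ^ (m - 1) : ℝ) : ℂ)) =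
      ∫ ξ, G (-ξ) * (N (-‖ξ‖) / ((‖ξ‖ ^ (m - 1) : ℝ) : ℂ)) := by
    rw [← integral_neg_eq_self]
    simp only [norm_neg]
  have hadd : ∀ ξ : EuclideanSpace ℝ (Fin m),
      G ξ * ((N ‖ξ‖ + N (-‖ξ‖)) / ((‖ξ‖ ^ (m - 1) : ℝ) : ℂ)) =
      G ξ * (N ‖ξ‖ / ((‖ξ‖ ^ (m - 1) : ℝ) : ℂ)) + G ξ * (N (-‖ξ‖) / ((‖ξ‖ ^ (m - 1) : ℝ) : ℂ)) :=
    fun ξ => by ring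
  simp only [hadd]
  refine ⟨h1.add h4', ?_⟩
  rw [integral_add h1 h4', h6', h3, h6, ← integral_add h2 h5]
  congr 1; ext u
  have hu : Integrable fun s : ℝ => G (s • (u : EuclideanSpace ℝ (Fin m))) * N s :=
    hN.bdd_mul (c := B) (hG.comp (by fun_prop)).aestronglyMeasurable (ae_of_all _ fun s => hB _)
  have h7 := integral_comp_neg_Ioi 0 fun s : ℝ => G (s • (u : EuclideanSpace ℝ (Fin m))) * N s
  simp only [neg_smul, neg_zero] at h7
  rw [h7, add_comm, ← integral_add_compl measurableSet_Iic hu, compl_Iic]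

section Operator

variable {ψ : 𝓢(ℝ, ℂ)} {η : 𝓢'(ℝ, ℂ)} {c : 𝓢(ℝ, ℂ)} {f : EuclideanSpace ℝ (Fin m) → ℂ}

/-- The Fourier transform of `f`, modulated so as to give Fourier inversion at `x`. -/
def modulatedFourier (f : EuclideanSpace ℝ (Fin m) → ℂ) (x ξ : EuclideanSpace ℝ (Fin m)) : ℂ :=
  𝓕 f ξ * Complex.exp (((2 * Real.pi * ⟪ξ, x⟫ : ℝ) : ℂ) * Complex.I)

theorem continuous_modulatedFourier (hf : Integrable f) (x : EuclideanSpace ℝ (Fin m)) :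
    Continuous (modulatedFourier f x) := by
  have := continuous_fourier_of_integrable hf
  unfold modulatedFourier
  fun_prop

theorem norm_modulatedFourier_le (f : EuclideanSpace ℝ (Fin m) → ℂ)
    (x ξ : EuclideanSpace ℝ (Fin m)) : ‖modulatedFourier f x ξ‖ ≤ ∫ y, ‖f y‖ := by
  rw [modulatedFourier, norm_mul, Complex.norm_exp_ofReal_mul_I, mul_one]
  exact norm_fourier_le_integral_norm f ξ

theorem innerConv_div_eq (hc : ∀ w, reflConv ψ η w = c w) (hf : Integrable f) (u : Sph m) {α : ℝ}
    (hα : 0 < α) (x : EuclideanSpace ℝ (Fin m)) :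
    innerConv ψ η f u α ⟪(u : EuclideanSpace ℝ (Fin m)), x⟫ / ((α ^ m : ℝ) : ℂ) =
      ∫ s : ℝ, modulatedFourier f x (s • (u : EuclideanSpace ℝ (Fin m))) *
        (𝓕 c (α * s) / ((α ^ m : ℝ) : ℂ)) := by
  rw [innerConv_eq hc hf u hα, ← integral_div]
  congr 1; ext s
  rw [modulatedFourier, real_inner_smul_left, mul_assoc (2 * Real.pi)]
  ring

theorem measurable_sphere_integrand (hf : Integrable f) (x : EuclideanSpace ℝ (Fin m))
    (C : 𝓢(ℝ, ℂ)) : Measurable fun q : (Sph m × ℝ) × ℝ =>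
      modulatedFourier f x (q.2 • (q.1.1 : EuclideanSpace ℝ (Fin m))) *
        (C (q.1.2 * q.2) / ((q.1.2 ^ m : ℝ) : ℂ)) := by
  have h1 := C.continuous.measurable
  have h2 := (continuous_modulatedFourier hf x).measurable
  fun_prop

theorem truncIntegrable_innerConv (hc : ∀ w, reflConv ψ η w = c w) (hf : Integrable f) {ε : ℝ}
    (hε : 0 < ε) (δ : ℝ) (x : EuclideanSpace ℝ (Fin m)) :
    TruncIntegrable ε δ (innerConv ψ η f) x := by
  let B := ∫ y, ‖f y‖
  have hB0 : 0 ≤ B := integral_nonneg fun _ => norm_nonneg _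
  have h1 : Integrable (fun q : Sph m × ℝ =>
      ∫ s : ℝ, modulatedFourier f x (s • (q.1 : EuclideanSpace ℝ (Fin m))) *
        (𝓕 c (q.2 * s) / ((q.2 ^ m : ℝ) : ℂ))) ((surf m).prod (volume.restrict (Ioo ε δ))) := by
    refine Integrable.of_bound (measurable_sphere_integrand hf x
      (𝓕 c)).stronglyMeasurable.integral_prod_right'.aestronglyMeasurable
      (B * ((ε ^ m)⁻¹ * (ε⁻¹ * ∫ s, ‖𝓕 c s‖))) ?_
    filter_upwards [ae_prod_restrict (m := m) (P := fun α => α ∈ Ioo ε δ) measurableSet_Ioo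
      fun r hr => hr] with q hq
    calc ‖∫ s : ℝ, modulatedFourier f x (s • (q.1 : EuclideanSpace ℝ (Fin m))) *
            (𝓕 c (q.2 * s) / ((q.2 ^ m : ℝ) : ℂ))‖
        ≤ ∫ s, B * ((ε ^ m)⁻¹ * ‖𝓕 c (q.2 * s)‖) := by
          refine norm_integral_le_of_norm_le
            ((((𝓕 c).integrable.comp_mul_left' (hε.trans hq.1).ne').norm.const_mul _).const_mul _)
            (ae_of_all _ fun s => ?_)
          rw [norm_mul]
          exact mul_le_mul (norm_modulatedFourier_le f x _) (norm_div_pow_le hε hq.1.le)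
            (norm_nonneg _) hB0
      _ = B * ((ε ^ m)⁻¹ * (q.2⁻¹ * ∫ s, ‖𝓕 c s‖)) := by
          rw [integral_const_mul, integral_const_mul, integral_norm_dilate _ (hε.trans hq.1)]
      _ ≤ _ := by
          have h0 : 0 ≤ ∫ s, ‖𝓕 c s‖ := integral_nonneg fun _ => norm_nonneg _
          have := hq.1.le
          gcongr
  refine h1.congr ?_
  filter_upwards [ae_prod_restrict (m := m) (P := fun α => α ∈ Ioo ε δ) measurableSet_Ioo
      fun r hr => hr] with q hq
  exact (innerConv_div_eq hc hf q.1 (hε.trans hq.1) x).symm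

theorem integrable_multiplier_mul (hm : 1 ≤ m) (hf : Integrable f) (C : 𝓢(ℝ, ℂ)) {ε : ℝ}
    (hε : 0 < ε) (δ : ℝ) :
    Integrable fun ξ => multiplier m C ε δ ξ * 𝓕 f ξ := by
  simp only [mul_comm _ (𝓕 f _)]
  exact (integral_sphere_line hm (measurable_dilationAverage m C ε δ)
    (integrable_dilationAverage C hε δ) (continuous_fourier_of_integrable hf)
    (norm_fourier_le_integral_norm f)).1

/-- The explicit formula for the truncated operator is a Fourier multiplier operator. -/
theorem truncInt_innerConv_eq (hm : 1 ≤ m) (hc : ∀ w, reflConv ψ η w = c w) (hf : Integrable f)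
    {ε : ℝ} (hε : 0 < ε) (δ : ℝ) (x : EuclideanSpace ℝ (Fin m)) :
    truncInt ε δ (innerConv ψ η f) x = 𝓕⁻ (fun ξ => multiplier m (𝓕 c) ε δ ξ * 𝓕 f ξ) x := by
  have hG := continuous_modulatedFourier hf x
  have hGB := norm_modulatedFourier_le f x
  have h1 : ∀ u : Sph m, ∫ α in Ioo ε δ,
      innerConv ψ η f u α ⟪(u : EuclideanSpace ℝ (Fin m)), x⟫ / ((α ^ m : ℝ) : ℂ) =
      ∫ s : ℝ, modulatedFourier f x (s • (u : EuclideanSpace ℝ (Fin m))) *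
        dilationAverage m (𝓕 c) ε δ s := fun u => by
    rw [setIntegral_congr_fun measurableSet_Ioo fun α (hα : α ∈ Ioo ε δ) =>
      innerConv_div_eq hc hf u (hε.trans hα.1) x, integral_integral_swap
      (integrable_dilate (𝓕 c) hε δ
        (g := fun s => modulatedFourier f x (s • (u : EuclideanSpace ℝ (Fin m))))
        (hG.comp (by fun_prop)).measurable fun s => hGB _)]
    simp only [integral_const_mul]
    rfl
  rw [truncInt]
  simp only [h1]
  rw [(integral_sphere_line hm (measurable_dilationAverage m (𝓕 c) ε δ)
    (integrable_dilationAverage (𝓕 c) hε δ) hG hGB).2, Real.fourierInv_eq']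
  congr 1; ext ξ
  rw [modulatedFourier, multiplier, smul_eq_mul]
  ring

end Operator

/-! ### The Fourier transform on `L² ∩ L¹` -/

section FourierL2

variable {V : Type*} [NormedAddCommGroup V] [InnerProductSpace ℝ V] [FiniteDimensional ℝ V]
  [MeasurableSpace V] [BorelSpace V]

theorem integral_fourierInv_mul_eq_of_integrable {f g : V → ℂ} (hf : Integrable f)
    (hg : Integrable g) : ∫ ξ, 𝓕⁻ f ξ * g ξ = ∫ x, f x * 𝓕⁻ g x := by
  rw [Real.fourierInv_eq_fourier_comp_neg, Real.fourierInv_eq_fourier_comp_neg,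
    integral_fourier_mul_eq_of_integrable hf.comp_neg hg, ← integral_neg_eq_self]
  congr 1; ext x
  rw [neg_neg, ← Real.fourierInv_eq_fourier_neg, ← Real.fourierInv_eq_fourier_comp_neg]

theorem ae_eq_of_integral_schwartz_mul_eq {f g : V → ℂ} (hf : LocallyIntegrable f)
    (hg : LocallyIntegrable g) (h : ∀ φ : 𝓢(V, ℂ), ∫ x, φ x * f x = ∫ x, φ x * g x) :
    f =ᵐ[volume] g := by
  refine ae_eq_of_integral_contDiff_smul_eq hf hg fun φ hφ hφc => ?_
  have hφd : ContDiff ℝ ∞ fun ζ => (φ ζ : ℂ) := Complex.ofRealCLM.contDiff.comp hφ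
  have hφc' : HasCompactSupport fun ζ => (φ ζ : ℂ) :=
    hφc.comp_left (g := ((↑) : ℝ → ℂ)) Complex.ofReal_zero
  exact h (hφc'.toSchwartzMap hφd)

/-- The Fourier transform on `L²` is given by the Fourier integral on `L¹ ∩ L²`: both have the
same pairing with Schwartz functions. -/
theorem coeFn_fourier_toLp {f : V → ℂ} (hf : Integrable f) (hf2 : MemLp f 2 volume) :
    (𝓕 (hf2.toLp f) : Lp ℂ 2 (volume : Measure V)) =ᵐ[volume] 𝓕 f := by
  refine ae_eq_of_integral_schwartz_mul_eq ((Lp.memLp _).locallyIntegrable one_le_two)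
    (continuous_fourier_of_integrable hf).locallyIntegrable fun φ => ?_
  have h1 := congrArg (fun T : 𝓢'(V, ℂ) => T φ) (Lp.fourier_toTemperedDistribution_eq (hf2.toLp f))
  simp only [TemperedDistribution.fourier_apply, Lp.toTemperedDistribution_apply, smul_eq_mul] at h1
  rw [← h1, ← integral_fourier_mul_eq_of_integrable φ.integrable hf]
  refine integral_congr_ae ?_
  filter_upwards [hf2.coeFn_toLp] with x hx
  rw [hx, SchwartzMap.fourier_coe]

theorem coeFn_fourierInv_toLp {f : V → ℂ} (hf : Integrable f) (hf2 : MemLp f 2 volume) :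
    (𝓕⁻ (hf2.toLp f) : Lp ℂ 2 (volume : Measure V)) =ᵐ[volume] 𝓕⁻ f := by
  have hc : Continuous (𝓕⁻ f) := by
    rw [Real.fourierInv_eq_fourier_comp_neg]
    exact continuous_fourier_of_integrable hf.comp_neg
  refine ae_eq_of_integral_schwartz_mul_eq ((Lp.memLp _).locallyIntegrable one_le_two)
    hc.locallyIntegrable fun φ => ?_
  have h1 := congrArg (fun T : 𝓢'(V, ℂ) => T φ)
    (Lp.fourierInv_toTemperedDistribution_eq (hf2.toLp f))
  simp only [TemperedDistribution.fourierInv_apply, Lp.toTemperedDistribution_apply, smul_eq_mul]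
    at h1
  rw [← h1, ← integral_fourierInv_mul_eq_of_integrable φ.integrable hf]
  refine integral_congr_ae ?_
  filter_upwards [hf2.coeFn_toLp] with x hx
  rw [hx, SchwartzMap.fourierInv_coe]

end FourierL2

/-! ### Bounds and limits of the multiplier -/

/-- The even part of `C(t) |t|^{-m}`, doubled: the density whose integrals over intervals of the
half-line are the values of the multiplier. -/
def evenDensity (m : ℕ) (C : 𝓢(ℝ, ℂ)) (t : ℝ) : ℂ :=
  C t / ((|t| ^ m : ℝ) : ℂ) + C (-t) / ((|t| ^ m : ℝ) : ℂ)

theorem integrable_evenDensity {C : 𝓢(ℝ, ℂ)}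
    (hC : Integrable fun t : ℝ => C t / ((|t| ^ m : ℝ) : ℂ)) : Integrable (evenDensity m C) := by
  refine hC.add ?_
  simpa only [abs_neg] using hC.comp_neg

theorem integral_Ioi_evenDensity {C : 𝓢(ℝ, ℂ)}
    (hC : Integrable fun t : ℝ => C t / ((|t| ^ m : ℝ) : ℂ)) :
    ∫ t in Ioi 0, evenDensity m C t = ∫ t : ℝ, C t / ((|t| ^ m : ℝ) : ℂ) := by
  have h1 : Integrable fun t : ℝ => C (-t) / ((|t| ^ m : ℝ) : ℂ) := by
    simpa only [abs_neg] using hC.comp_neg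
  have h2 := integral_comp_neg_Ioi 0 fun t : ℝ => C t / ((|t| ^ m : ℝ) : ℂ)
  simp only [abs_neg, neg_zero] at h2
  simp only [evenDensity]
  rw [integral_add hC.restrict h1.restrict, h2, add_comm,
    ← integral_add_compl measurableSet_Iic hC, compl_Iic]

theorem setIntegral_dilate (P : ℝ → ℂ) (hm : 1 ≤ m) {ε δ r : ℝ} (hε : 0 < ε) (hδ : ε ≤ δ)
    (hr : 0 < r) : ∫ α in Ioo ε δ, P (α * r) / ((α ^ m : ℝ) : ℂ) =
      ((r ^ (m - 1) : ℝ) : ℂ) * ∫ t in Ioo (ε * r) (δ * r), P t / ((|t| ^ m : ℝ) : ℂ) := by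
  have h := intervalIntegral.integral_comp_mul_right (a := ε) (b := δ)
    (fun t => P t / ((|t| ^ m : ℝ) : ℂ)) hr.ne'
  rw [intervalIntegral.integral_of_le hδ, intervalIntegral.integral_of_le (by gcongr),
    integral_Ioc_eq_integral_Ioo, integral_Ioc_eq_integral_Ioo, eq_inv_smul_iff₀ hr.ne',
    Complex.real_smul] at h
  rw [← h, ← mul_assoc, ← Complex.ofReal_mul, ← pow_succ, Nat.sub_add_cancel hm,
    ← integral_const_mul]
  refine setIntegral_congr_fun measurableSet_Ioo fun α hα => ?_
  have hα0 : 0 < α := hε.trans hα.1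
  have h1 : ((α ^ m : ℝ) : ℂ) ≠ 0 := by exact_mod_cast (pow_pos hα0 m).ne'
  have h2 : ((r ^ m : ℝ) : ℂ) ≠ 0 := by exact_mod_cast (pow_pos hr m).ne'
  rw [abs_of_pos (by positivity), mul_pow, Complex.ofReal_mul]
  field_simp

theorem multiplier_eq_setIntegral (hm : 1 ≤ m) {C : 𝓢(ℝ, ℂ)}
    (hC : Integrable fun t : ℝ => C t / ((|t| ^ m : ℝ) : ℂ)) {ε δ : ℝ} (hε : 0 < ε) (hδ : ε ≤ δ)
    {ξ : EuclideanSpace ℝ (Fin m)} (hξ : ξ ≠ 0) :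
    multiplier m C ε δ ξ = ∫ t in Ioo (ε * ‖ξ‖) (δ * ‖ξ‖), evenDensity m C t := by
  have hr : 0 < ‖ξ‖ := norm_pos_iff.2 hξ
  have h1 : Integrable fun t : ℝ => C (-t) / ((|t| ^ m : ℝ) : ℂ) := by
    simpa only [abs_neg] using hC.comp_neg
  have h2 := setIntegral_dilate (fun t => C t) hm hε hδ hr
  have h3 := setIntegral_dilate (fun t => C (-t)) hm hε hδ hr
  have h0 : ((‖ξ‖ ^ (m - 1) : ℝ) : ℂ) ≠ 0 := by exact_mod_cast (pow_pos hr _).ne'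
  simp only [multiplier, dilationAverage, mul_neg, evenDensity]
  rw [h2, h3, ← mul_add, mul_div_cancel_left₀ _ h0, integral_add hC.restrict h1.restrict]

theorem norm_multiplier_le (hm : 1 ≤ m) {C : 𝓢(ℝ, ℂ)}
    (hC : Integrable fun t : ℝ => C t / ((|t| ^ m : ℝ) : ℂ)) {ε δ : ℝ} (hε : 0 < ε) (hδ : ε ≤ δ)
    {ξ : EuclideanSpace ℝ (Fin m)} (hξ : ξ ≠ 0) :
    ‖multiplier m C ε δ ξ‖ ≤ ∫ t, ‖evenDensity m C t‖ := by
  rw [multiplier_eq_setIntegral hm hC hε hδ hξ]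
  exact (norm_integral_le_integral_norm _).trans
    (setIntegral_le_integral (integrable_evenDensity hC).norm (ae_of_all _ fun _ => norm_nonneg _))

theorem eventually_zero_lt_and_lt :
    ∀ᶠ p : ℝ × ℝ in 𝓝[>] (0 : ℝ) ×ˢ atTop, 0 < p.1 ∧ p.1 < p.2 := by
  have h1 : ∀ᶠ e : ℝ in 𝓝[>] (0 : ℝ), 0 < e ∧ e < 1 :=
    Ioo_mem_nhdsGT one_pos
  filter_upwards [h1.prod_mk (eventually_gt_atTop (1 : ℝ))] with p hp
  exact ⟨hp.1.1, hp.1.2.trans hp.2⟩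

theorem tendsto_multiplier (hm : 1 ≤ m) {C : 𝓢(ℝ, ℂ)}
    (hC : Integrable fun t : ℝ => C t / ((|t| ^ m : ℝ) : ℂ))
    {ξ : EuclideanSpace ℝ (Fin m)} (hξ : ξ ≠ 0) :
    Tendsto (fun p : ℝ × ℝ => multiplier m C p.1 p.2 ξ) (𝓝[>] (0 : ℝ) ×ˢ atTop)
      (𝓝 (∫ t : ℝ, C t / ((|t| ^ m : ℝ) : ℂ))) := by
  have hr : 0 < ‖ξ‖ := norm_pos_iff.2 hξ
  have hi := integrable_evenDensity hC
  rw [← integral_Ioi_evenDensity hC, ← integral_indicator measurableSet_Ioi]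
  have h1 : Tendsto (fun p : ℝ × ℝ =>
      ∫ t, (Ioo (p.1 * ‖ξ‖) (p.2 * ‖ξ‖)).indicator (evenDensity m C) t) (𝓝[>] (0 : ℝ) ×ˢ atTop)
      (𝓝 (∫ t, (Ioi 0).indicator (evenDensity m C) t)) := by
    refine tendsto_integral_filter_of_dominated_convergence (fun t => ‖evenDensity m C t‖)
      (Eventually.of_forall fun p => (hi.indicator measurableSet_Ioo).aestronglyMeasurable)
      (Eventually.of_forall fun p => ae_of_all _ fun t => norm_indicator_le_norm_self _ _) hi.norm
      (ae_of_all _ fun t => tendsto_const_nhds.congr' ?_)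
    rcases le_or_gt t 0 with ht | ht
    · filter_upwards [eventually_zero_lt_and_lt] with p hp
      rw [indicator_of_notMem (by simpa using ht), indicator_of_notMem]
      exact fun h => absurd (h.1.trans_le ht) (not_lt.2 (mul_pos hp.1 hr).le)
    · have h2 : ∀ᶠ e : ℝ in 𝓝[>] (0 : ℝ), e * ‖ξ‖ < t := by
        have : Tendsto (fun e : ℝ => e * ‖ξ‖) (𝓝[>] (0 : ℝ)) (𝓝 0) :=
          ((continuous_mul_const ‖ξ‖).tendsto' 0 0 (zero_mul _)).mono_left nhdsWithin_le_nhds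
        exact this.eventually (gt_mem_nhds ht)
      have h3 : ∀ᶠ d : ℝ in atTop, t < d * ‖ξ‖ :=
        (tendsto_id.atTop_mul_const hr).eventually_gt_atTop t
      filter_upwards [h2.prod_mk h3] with p hp
      rw [indicator_of_mem (show t ∈ Ioi 0 from ht), indicator_of_mem (show t ∈ Ioo _ _ from hp)]
  refine h1.congr' ?_
  filter_upwards [eventually_zero_lt_and_lt] with p hp
  rw [multiplier_eq_setIntegral hm hC hp.1 hp.2.le hξ, integral_indicator measurableSet_Ioo]

/-! ### The truncated reconstruction operator on `L²` -/

theorem ae_ne_zero (hm : 1 ≤ m) : ∀ᵐ ξ : EuclideanSpace ℝ (Fin m), ξ ≠ 0 := by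
  have hnt : Nonempty (Fin m) := ⟨⟨0, hm⟩⟩
  exact Measure.ae_ne volume 0

theorem memLp_top_multiplier (hm : 1 ≤ m) {C : 𝓢(ℝ, ℂ)}
    (hC : Integrable fun t : ℝ => C t / ((|t| ^ m : ℝ) : ℂ)) {ε δ : ℝ} (hε : 0 < ε) (hδ : ε ≤ δ) :
    MemLp (multiplier m C ε δ) ⊤ volume :=
  memLp_top_of_bound (measurable_multiplier m C ε δ).aestronglyMeasurable _
    ((ae_ne_zero hm).mono fun _ hξ => norm_multiplier_le hm hC hε hδ hξ)

/-- The Fourier multiplier operator on `L²` with a bounded symbol. -/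
def fourierMultiplier {M : EuclideanSpace ℝ (Fin m) → ℂ} (hM : MemLp M ⊤ volume) : L2 m →L[ℂ] L2 m :=
  (FourierTransform.fourierInvCLM ℂ (L2 m)).comp
    (((ContinuousLinearMap.mul ℂ ℂ).holderL volume ⊤ 2 2 (hM.toLp M)).comp
      (FourierTransform.fourierCLM ℂ (L2 m)))

theorem coeFn_fourier_fourierMultiplier {M : EuclideanSpace ℝ (Fin m) → ℂ} (hM : MemLp M ⊤ volume)
    (f : L2 m) : (𝓕 (fourierMultiplier hM f) : L2 m) =ᵐ[volume] fun ξ => M ξ * (𝓕 f : L2 m) ξ := by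
  have h : 𝓕 (fourierMultiplier hM f) =
      (ContinuousLinearMap.mul ℂ ℂ).holder 2 (hM.toLp M) (𝓕 f : L2 m) :=
    FourierTransform.fourier_fourierInv_eq _
  rw [h]
  filter_upwards [(ContinuousLinearMap.mul ℂ ℂ).coeFn_holder (r := 2) (hM.toLp M) (𝓕 f : L2 m),
    hM.coeFn_toLp] with ξ h1 h2
  rw [h1, h2]; rfl

theorem coeFn_fourierMultiplier_toLp {M : EuclideanSpace ℝ (Fin m) → ℂ} (hM : MemLp M ⊤ volume)
    {f : EuclideanSpace ℝ (Fin m) → ℂ} (hf : Integrable f) (hf2 : MemLp f 2 volume)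
    (hMf : Integrable fun ξ => M ξ * 𝓕 f ξ) :
    fourierMultiplier hM (hf2.toLp f) =ᵐ[volume] 𝓕⁻ fun ξ => M ξ * 𝓕 f ξ := by
  have h1 : (𝓕 (fourierMultiplier hM (hf2.toLp f)) : L2 m) =ᵐ[volume] fun ξ => M ξ * 𝓕 f ξ := by
    filter_upwards [coeFn_fourier_fourierMultiplier hM (hf2.toLp f), coeFn_fourier_toLp hf hf2]
      with ξ h1 h2
    rw [h1, h2]
  have h2 : MemLp (fun ξ => M ξ * 𝓕 f ξ) 2 volume := (Lp.memLp _).ae_eq h1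
  have h3 : 𝓕 (fourierMultiplier hM (hf2.toLp f)) = h2.toLp _ :=
    Lp.ext (h1.trans h2.coeFn_toLp.symm)
  have h4 : fourierMultiplier hM (hf2.toLp f) = 𝓕⁻ (h2.toLp fun ξ => M ξ * 𝓕 f ξ) := by
    rw [← h3, FourierTransform.fourierInv_fourier_eq]
  rw [h4]
  exact coeFn_fourierInv_toLp hMf h2

theorem truncInt_congr {ε δ : ℝ} (hε : 0 < ε) {D D' : Sph m → ℝ → ℝ → ℂ}
    (h : ∀ u α β, 0 < α → D u α β = D' u α β) (x : EuclideanSpace ℝ (Fin m)) :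
    truncInt ε δ D x = truncInt ε δ D' x := by
  rw [truncInt, truncInt]
  congr 1; ext u
  exact setIntegral_congr_fun measurableSet_Ioo fun α hα => by
    rw [h u α _ (hε.trans hα.1)]

theorem TruncIntegrable.congr {ε δ : ℝ} (hε : 0 < ε) {D D' : Sph m → ℝ → ℝ → ℂ}
    (h : ∀ u α β, 0 < α → D u α β = D' u α β) {x : EuclideanSpace ℝ (Fin m)}
    (hD : TruncIntegrable ε δ D x) : TruncIntegrable ε δ D' x := by
  refine Integrable.congr hD ?_
  filter_upwards [ae_prod_restrict (m := m) (P := fun α => α ∈ Ioo ε δ) measurableSet_Ioo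
    fun r hr => hr] with q hq
  rw [h _ _ _ (hε.trans hq.1)]

variable {ψ : 𝓢(ℝ, ℂ)} {η : 𝓢'(ℝ, ℂ)} {c : 𝓢(ℝ, ℂ)}

theorem isTruncatedReconstruction_fourierMultiplier (hm : 1 ≤ m)
    (hc : ∀ w, reflConv ψ η w = c w) {ε δ : ℝ} (hε : 0 < ε)
    (hM : MemLp (multiplier m (𝓕 c) ε δ) ⊤ volume) :
    IsTruncatedReconstruction m ψ η ε δ (fourierMultiplier hM) := by
  have hconv : ∀ (f : EuclideanSpace ℝ (Fin m) → ℂ), Integrable f →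
      ∀ hf : MemLp f 2 volume,
        fourierMultiplier hM (hf.toLp f) =ᵐ[volume] truncInt ε δ (innerConv ψ η f) := by
    intro f hf hf2
    refine (coeFn_fourierMultiplier_toLp hM hf hf2
      (integrable_multiplier_mul hm hf (𝓕 c) hε δ)).trans (ae_of_all _ fun x => ?_)
    exact (truncInt_innerConv_eq hm hc hf hε δ x).symm
  refine ⟨fun f u α β hα => ⟨𝓕 (ridgeletHat ψ f u α β), fourier_ridgeletHat ψ f u hα β⟩,
    fun f x => ?_, fun f => ?_, fun f hf u α β hα => ?_,
    fun f hf x => truncIntegrable_innerConv hc hf hε δ x, hconv⟩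
  · exact (truncIntegrable_innerConv hc f.integrable hε δ x).congr hε fun u α β hα =>
      (dualInner_ridgelet_eq_innerConv hc f u hα β).symm
  · refine (hconv f f.integrable (f.memLp 2)).trans (ae_of_all _ fun x => ?_)
    exact truncInt_congr hε (fun u α β hα => (dualInner_ridgelet_eq_innerConv hc f u hα β).symm) x
  · refine (integrable_radon hf u).mul_bdd
      (c := (SchwartzMap.seminorm ℝ 0 0) c / |α|) ?_ (ae_of_all _ fun p => ?_)
    · simp only [hc]
      exact Continuous.aestronglyMeasurable (by fun_prop)
    · rw [hc, norm_div, Complex.norm_real, Real.norm_eq_abs]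
      gcongr
      exact SchwartzMap.norm_le_seminorm ℝ c _

/-- The explicit formula on Schwartz functions determines the operator. -/
theorem IsTruncatedReconstruction.unique {ε δ : ℝ} {I J : L2 m →L[ℂ] L2 m}
    (hI : IsTruncatedReconstruction m ψ η ε δ I) (hJ : IsTruncatedReconstruction m ψ η ε δ J) :
    I = J := by
  have hd := SchwartzMap.denseRange_toLpCLM (E := EuclideanSpace ℝ (Fin m)) (F := ℂ) (p := 2)
    ENNReal.ofNat_ne_top (μ := volume)
  refine DFunLike.coe_injective (hd.equalizer I.continuous J.continuous ?_)
  ext1 f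
  exact Lp.ext ((hI.schwartz_eq f).trans (hJ.schwartz_eq f).symm)

/-- Plancherel's theorem for the error of a Fourier multiplier operator. -/
theorem norm_sq_fourierMultiplier_sub {M : EuclideanSpace ℝ (Fin m) → ℂ} (hM : MemLp M ⊤ volume)
    (f : L2 m) : ‖fourierMultiplier hM f - f‖ ^ 2 =
      ∫ ξ, ‖M ξ - 1‖ ^ 2 * ‖(𝓕 f : L2 m) ξ‖ ^ 2 := by
  have h1 : ‖fourierMultiplier hM f - f‖ = ‖(𝓕 (fourierMultiplier hM f - f) : L2 m)‖ :=
    (Lp.norm_fourier_eq _).symm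
  have h2 : (𝓕 (fourierMultiplier hM f - f) : L2 m) =
      𝓕 (fourierMultiplier hM f) - 𝓕 f :=
    map_sub (FourierTransform.fourierCLM ℂ (L2 m)) _ _
  have h3 := inner_self_eq_norm_sq (𝕜 := ℂ) (𝓕 (fourierMultiplier hM f - f) : L2 m)
  rw [h1, ← h3, L2.inner_def, ← integral_re (L2.integrable_inner _ _), h2]
  refine integral_congr_ae ?_
  filter_upwards [Lp.coeFn_sub (𝓕 (fourierMultiplier hM f) : L2 m) (𝓕 f : L2 m),
    coeFn_fourier_fourierMultiplier hM f] with ξ h4 h5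
  rw [h4, Pi.sub_apply, h5, inner_self_eq_norm_sq, ← mul_pow, ← norm_mul]
  congr 2; ring

/-- The truncated operators converge strongly to the identity, because their multipliers are
uniformly bounded and converge to `1` pointwise. -/
theorem tendsto_of_isTruncatedReconstruction (hm : 1 ≤ m) (hc : ∀ w, reflConv ψ η w = c w)
    (hC : Integrable fun t : ℝ => 𝓕 c t / ((|t| ^ m : ℝ) : ℂ))
    (hC1 : ∫ t : ℝ, 𝓕 c t / ((|t| ^ m : ℝ) : ℂ) = 1) {I : ℝ → ℝ → (L2 m →L[ℂ] L2 m)}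
    (hI : ∀ ε δ : ℝ, 0 < ε → ε < δ → IsTruncatedReconstruction m ψ η ε δ (I ε δ)) (f : L2 m) :
    Tendsto (fun p : ℝ × ℝ => I p.1 p.2 f) (𝓝[>] (0 : ℝ) ×ˢ atTop) (𝓝 f) := by
  let B := ∫ t, ‖evenDensity m (𝓕 c) t‖
  have hF : Integrable fun ξ => ‖(𝓕 f : L2 m) ξ‖ ^ 2 :=
    (memLp_two_iff_integrable_sq_norm (Lp.aestronglyMeasurable _)).1 (Lp.memLp (𝓕 f : L2 m))
  have hlim : Tendsto (fun p : ℝ × ℝ =>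
      ∫ ξ, ‖multiplier m (𝓕 c) p.1 p.2 ξ - 1‖ ^ 2 * ‖(𝓕 f : L2 m) ξ‖ ^ 2)
      (𝓝[>] (0 : ℝ) ×ˢ atTop) (𝓝 (∫ _ : EuclideanSpace ℝ (Fin m), (0 : ℝ))) := by
    refine tendsto_integral_filter_of_dominated_convergence
      (fun ξ => (B + 1) ^ 2 * ‖(𝓕 f : L2 m) ξ‖ ^ 2) (Eventually.of_forall fun p => ?_) ?_
      (hF.const_mul _) ((ae_ne_zero hm).mono fun ξ hξ => ?_)
    · exact (((measurable_multiplier m (𝓕 c) p.1 p.2).sub_const 1).norm.pow_const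
        2).aestronglyMeasurable.mul hF.aestronglyMeasurable
    · filter_upwards [eventually_zero_lt_and_lt] with p hp
      filter_upwards [ae_ne_zero hm] with ξ hξ
      rw [Real.norm_of_nonneg (by positivity)]
      gcongr
      refine (norm_sub_le _ _).trans ?_
      rw [norm_one]
      gcongr
      exact norm_multiplier_le hm hC hp.1 hp.2.le hξ
    · have h := ((tendsto_multiplier hm hC hξ).sub_const 1).norm
      rw [hC1, sub_self, norm_zero] at h
      simpa using (h.pow 2).mul_const (‖(𝓕 f : L2 m) ξ‖ ^ 2)
  rw [integral_zero] at hlim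
  have hsq : Tendsto (fun p : ℝ × ℝ => ‖I p.1 p.2 f - f‖ ^ 2) (𝓝[>] (0 : ℝ) ×ˢ atTop) (𝓝 0) := by
    refine hlim.congr' ?_
    filter_upwards [eventually_zero_lt_and_lt] with p hp
    have hM := memLp_top_multiplier hm hC hp.1 hp.2.le
    rw [(hI _ _ hp.1 hp.2).unique (isTruncatedReconstruction_fourierMultiplier hm hc hp.1 hM),
      norm_sq_fourierMultiplier_sub]
  rw [tendsto_iff_norm_sub_tendsto_zero]
  simpa [Real.sqrt_sq] using hsq.sqrt

/-- The convolution `conj ψ̃ * η` of an admissibly decomposable pair is a Schwartz function. -/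
theorem AdmissiblyDecomposable.exists_schwartz (h : AdmissiblyDecomposable m ψ η) :
    ∃ c : 𝓢(ℝ, ℂ), ∀ w, reflConv ψ η w = c w := by
  obtain ⟨-, ψs, ηs, -, -, -, -, heq⟩ := h
  let r : 𝓢(ℝ, ℂ) := SchwartzMap.compCLMOfContinuousLinearEquiv ℂ (ContinuousLinearEquiv.neg ℝ)
    (conjS ψs)
  refine ⟨SchwartzMap.convolution (ContinuousLinearMap.mul ℂ ℂ) ηs r, fun w => ?_⟩
  have h1 : reflConv ψs (toDist ηs) w = ∫ z, conjS ψs (z - w) * ηs z := by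
    simp [reflConv, toDist, SchwartzMap.toTemperedDistributionCLM_apply_apply]
  rw [← heq, h1, SchwartzMap.convolution_apply, MeasureTheory.convolution]
  congr 1; ext z
  have h2 : r (w - z) = conjS ψs (z - w) := by
    change conjS ψs (-(w - z)) = _
    rw [neg_sub]
  rw [ContinuousLinearMap.mul_apply', h2, mul_comm]

end Ridgelet

end

theorem mainTheorem3 (m : ℕ) (hm : 1 ≤ m) (ψ : 𝓢(ℝ, ℂ)) (η : 𝓢'(ℝ, ℂ))
    (hdec : Ridgelet.AdmissiblyDecomposable m ψ η)
    (hK : Ridgelet.HasAdmissibilityConstant m ψ η 1) :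
    (∀ ε δ : ℝ, 0 < ε → ε < δ →
      ∃! I : Ridgelet.L2 m →L[ℂ] Ridgelet.L2 m,
        Ridgelet.IsTruncatedReconstruction m ψ η ε δ I) ∧
    (∀ I : ℝ → ℝ → (Ridgelet.L2 m →L[ℂ] Ridgelet.L2 m),
      (∀ ε δ : ℝ, 0 < ε → ε < δ →
        Ridgelet.IsTruncatedReconstruction m ψ η ε δ (I ε δ)) →
      ∀ f : Ridgelet.L2 m,
        Tendsto (fun p : ℝ × ℝ => I p.1 p.2 f) (𝓝[>] (0 : ℝ) ×ˢ atTop) (𝓝 f)) := by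
  obtain ⟨c, hc⟩ := hdec.exists_schwartz
  obtain ⟨hC, hC1⟩ := hK.integral_eq hm hc
  refine ⟨fun ε δ hε hδ => ?_, fun I hI f =>
    Ridgelet.tendsto_of_isTruncatedReconstruction hm hc hC hC1 hI f⟩
  have hM := Ridgelet.memLp_top_multiplier hm hC hε hδ.le
  exact ⟨Ridgelet.fourierMultiplier hM,
    Ridgelet.isTruncatedReconstruction_fourierMultiplier hm hc hε hM, fun J hJ =>
      hJ.unique (Ridgelet.isTruncatedReconstruction_fourierMultiplier hm hc hε hM)⟩
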